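/- **Parameters and paths.** A *parameter* is a totally ordered commutative monoid $(\Lambda,<,+,0)$ such that $a<b\iff a+c<b+c$; whenever $a<b$ there is $c$ with $a+c=b$ (written $c=b-a$); some element is $>0$; and every non-empty subset bounded above has a least upper bound. A *dynamic set* $S$ is a non-empty set of functions (*paths*) $\bar p$ on one parameter $\Lambda=\Lambda_S$; $\mathcal P_S$ is the set of values (*states*) of its paths. For $x_1\in\Lambda\cup\{-\infty\}$, $x_2\in\Lambda\cup\{\infty\}$, $\bar p[x_1,x_2]$ is the restriction of $\bar p$ to the interval $[x_1,x_2]$, $S[x_1,x_2]=\{\bar p[x_1,x_2]:\bar p\in S\}$ and $S(\lambda)=\{\bar p(\lambda):\bar p\in S\}$. If $\bar p(\lambda)=\bar q(\lambda)$, $\bar p[x_1,\lambda]\circ\bar q[\lambda,x_2]$ is the concatenation, and $A\circ B$ is the set of all concatenations of an element of $A$ with an element of $B$. A path on $\Lambda$ is identified with its restriction to $[-\infty,\infty]$. For a set $A$ of partial paths, $\rightarrow A\rightarrow$ is the set of all $\bar p\in S[-\infty,x_1]\circ\bar p'[x_1,x_2]\circ S[x_2,\infty]$ with $\bar p'[x_1,x_2]\in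 A$ (the left or right factor being omitted if $x_1=-\infty$ or $x_2=\infty$), and $+A=(\rightarrow A\rightarrow)\cap S$. A *dynamic space* is a dynamic set $D$ such that $\bar p[-\infty,\lambda]\circ\bar q[\lambda,\infty]\in D$ whenever $\bar p,\bar q\in D$ and $\bar p(\lambda)=\bar q(\lambda)$. **Ideal partitions.** Given a family $\mathcal B$ of sets and a set $A$, put $|A|_0=A$, let $|A|_{n+1}$ be the union of the $B\in\mathcal B$ that intersect $|A|_n$, and $|A|=\bigcup_n|A|_n$. For a covering $K$ of $S$ (a set of subsets of $S$ with $\bigcup K=S$) and $\alpha\in K$, $|\alpha[-\infty,\lambda]|$ is formed with $\mathcal B=\{\beta[-\infty,\lambda]:\beta\in K\}$. A partition $\gamma$ of $S$ into non-empty sets is an *ideal partition* if 1. there is $\lambda_0\in\Lambda$ such that $\alpha=S[-\infty,\lambda]\circ\alpha[\lambda,\infty]$ for all $\alpha\in\gamma$ and $\lambda\le\lambda_0$; 2. for every $\alpha\in\gamma$ there is $\lambda$ with $\alpha=+\alpha[-\infty,\lambda]$; 3. $\alpha=|\alpha[-\infty,\lambda]|\circ\alpha[\lambda,\infty]$ for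 all $\alpha\in\gamma$ and $\lambda\in\Lambda$. **Shells.** A *shell* is a triple $(D,I,F)$ with $D$ a dynamic space and $I,F\subset\mathcal P_D$ such that: 1. $D$ is homogeneous: if $\lambda_1\le\lambda_2$ and $p\in D(\lambda_1)\cap D(\lambda_2)$, then a function $\bar p$ on $\Lambda$ is a path in $D$ with $\bar p(\lambda_1)=p$ iff there is $\bar p'\in D$ with $\bar p'(\lambda_2)=p$ and $\bar p(\lambda)=\bar p'(\lambda+(\lambda_2-\lambda_1))$ for all $\lambda\in\Lambda$. 2. $I\subset D(\lambda)$ for every $\lambda\in\Lambda$. 3. If $\bar p\in D$ and $\bar p(\lambda_1)\in I$, there is $\lambda_2\ge\lambda_1$ with $\bar p(\lambda_2)\in F$ and $\bar p(\lambda)\notin I$ for $\lambda\in(\lambda_1,\lambda_2]$. 4. If $\bar p\in D$ and $\bar p(\lambda_2)\in F$, there is $\lambda_1\le\lambda_2$ with $\bar p(\lambda_1)\in I$ and $\bar p(\lambda)\notin I$ for $\lambda\in(\lambda_1,\lambda_2]$. $Int(Z)$ is the set of states $\bar p(\lambda_2)$ with $\bar p\in D$, $\bar p(\lambda_1)\in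 I$ for some $\lambda_1\le\lambda_2$, and $\bar p(\lambda)\notin F$ for $\lambda\in[\lambda_1,\lambda_2)$; $Dom(Z)=F\cup Int(Z)$. An *environmental shell* $Z$ is a shell with sets $\mathcal S_Z,\mathcal E_{Int(Z)},\mathcal E_F$ such that $(\mathcal S_Z\times\mathcal E_{Int(Z)})\cap\mathcal P_D=Int(Z)$, $(\mathcal S_Z\times\mathcal E_F)\cap\mathcal P_D=F$, and $\mathcal S_Z$, $\mathcal E_{Int(Z)}$, $\mathcal E_F$ are the projections of $Dom(Z)$ to the first, of $Int(Z)$ to the second, and of $F$ to the second coordinate. For a set $A$ of segments of paths of pairs, $A\cdot\mathcal S$ and $A\cdot\mathcal E$ are the sets of their first and second components. **Outcomes.** For a set $A$ of states, $I\upharpoonleft I\rightarrow A$ is the set of segments $\bar p[\lambda_1,\lambda_2]$, $\bar p\in D$, $\lambda_1\le\lambda_2$, with $\bar p(\lambda_1)\in I$, $\bar p(\lambda_2)\in A$ and $\bar p(\lambda)\notin I$ for $\lambda\in(\lambda_1,\lambda_2]$; $\omega_A$ is the set of those that start at $0$. $D_{I/F}$ is the set of segments $\bar p[\lambda_1,\lambda_2]$,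 $\bar p\in D$, $\bar p(\lambda_1)\in I$, where $\lambda_2$ is the greatest lower bound of the non-empty set $\{\lambda\ge\lambda_1:\bar p(\lambda)\in F\}$. $\Theta^\lambda_A$ is the set of $\bar p[\lambda,\lambda']\in D_{I/F}$ that are initial segments of some $\bar p'[\lambda,\lambda'']\in I\upharpoonleft I\rightarrow A$, and $\Theta_A=\Theta^0_A$. For $X\subset\mathcal E_F$, $\mathcal O^\lambda_X=\Theta^\lambda_{\mathcal S_Z\times X}\cdot\mathcal S$, $\mathcal O_X=\mathcal O_X^0$, $\mathcal O_F=\mathcal O_{\mathcal E_F}$, $\mathcal O_e=\mathcal O_{\{e\}}$, $\omega_e=\omega_{\mathcal S_Z\times\{e\}}$. For a state $p$, $\Sigma_p$ (resp. $\Sigma_{p\rightarrow}$) is the set of system components of $\bar p[0,\lambda_1]$ (resp. $\bar p[\lambda_1,\lambda_2]$), where $\bar p[0,\lambda_2]\in\Theta_F$, $\lambda_1\in[0,\lambda_2]$ and $\bar p(\lambda_1)=p$. For $\lambda\ge0$, $\mathcal O_e[0,\lambda]$ is the set of $\bar s[0,\lambda]$ with $\bar s[0,\lambda']\in\mathcal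 O_e$ for some $\lambda'\ge\lambda$, and $|\mathcal O_e[0,\lambda]|$ is formed with $\mathcal B=\{\mathcal O_{e'}[0,\lambda]:e'\in\mathcal E_F\}$. For $\bar e:\Lambda\to\mathcal E_{Int(Z)}\cup\mathcal E_F$, $\mathcal O_{\bar e[0,\lambda]}$ is the set of system components of those elements of $\Theta_F$ that are initial segments of some $\bar p[0,\lambda]\in\omega_{Dom(Z)}$ whose environmental component is $\bar e[0,\lambda]$. **Ideal e-automata.** $p,p'\in Int(Z)$ are *undifferentiated* if for some $e\in\mathcal E_F$ and $\lambda\ge0$ both $\Sigma_p$ and $\Sigma_{p'}$ intersect $|\mathcal O_e[0,\lambda]|$. An environmental shell $Z$ is an *e-automaton* if - (weakly unbiased) whenever $(s,e_1)$ and $(s,e_2)$ are undifferentiated and both are values at $\lambda$ of elements of $\Theta_F$, for every $\bar s_1[\lambda,\lambda_1]\in\Sigma_{(s,e_1)\rightarrow}$ there is $\bar s_2[\lambda,\lambda_2]\in\Sigma_{(s,e_2)\rightarrow}$ with $\bar s_1=\bar s_2$ on $[\lambda,\min(\lambda_1,\lambda_2)]$, and conversely; - (automata condition) if $\bar s_1[0,\lambda_1],\bar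 s_2[0,\lambda_2]\in\mathcal O_F$ and $\lambda_1<\lambda_2$ then $\bar s_1[0,\lambda_1]\ne\bar s_2[0,\lambda_1]$. It is *ideal* if moreover for all $e,e'\in\mathcal E_F$ either $\mathcal O_e=\mathcal O_{e'}$ or $\mathcal O_e\cap\mathcal O_{e'}=\emptyset$, and for every $e\in\mathcal E_F$ and every $\bar e[0,\lambda]\in\omega_e\cdot\mathcal E$, $\mathcal O_{\bar e[0,\lambda]}=\mathcal O_e$. **Deciding.** A covering $K$ of a dynamic set $S$ is *decided* by an e-automaton $Z=(D,I,F)$ if $\Lambda_S=\Lambda_D$ and for some $\lambda\in\Lambda_S$: 1. every $\bar s[\lambda,\lambda']\in\mathcal O^\lambda_F$ is in $S[\lambda,\lambda']$; 2. $S=S[-\infty,\lambda']\circ S[\lambda',\infty]$ for all $\lambda'\le\lambda$; and for all $a\in K$, $\lambda'>\lambda$ and $\bar p_1,\bar p_2\in+|a[-\infty,\lambda']|$ with $\bar p_1(\lambda')=\bar p_2(\lambda')$, $\bar p_1[-\infty,\lambda']\circ\bar p_2[\lambda',\infty]\in S$; 3. $K=\{+\mathcal O^\lambda_e:e\in\mathcal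 E_F\}$. **Theorem.** Every ideal partition of a dynamic set is decided by some ideal e-automaton. -/

import Mathlib

universe u v w

namespace Dyn

/-! ### Parameters -/

/-- A parameter `(Λ, <, +, 0)`: a totally ordered commutative monoid with translation-invariant
strict order, with differences `l₂ - l₁` for `l₁ < l₂`, with a positive element, and in which
every non-empty subset that is bounded above has a least upper bound. -/
class IsParameter (Λ : Type u) [AddCommMonoid Λ] [LinearOrder Λ] : Prop where
  lt_iff_add_lt_add : ∀ a b c : Λ, a < b ↔ a + c < b + c
  exists_add_eq_of_lt : ∀ a b : Λ, a < b → ∃ c : Λ, a + c = b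
  exists_pos : ∃ a : Λ, 0 < a
  exists_isLUB : ∀ X : Set Λ, X.Nonempty → BddAbove X → ∃ m : Λ, IsLUB X m

/-! ### Partial paths -/

section Paths

variable {Λ : Type u} [LinearOrder Λ] {P : Type v}

/-- The interval `[x₁, x₂]`, where `x₁ = -∞` and `x₂ = ∞` are allowed. -/
def itv (x₁ : WithBot Λ) (x₂ : WithTop Λ) : Set Λ :=
  {l | x₁ ≤ (l : WithBot Λ) ∧ (l : WithTop Λ) ≤ x₂}

/-- The partial path `p[x₁, x₂]`: the partial function obtained by restricting `p` to the
interval `[x₁, x₂]`. -/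
noncomputable def seg (p : Λ → P) (x₁ : WithBot Λ) (x₂ : WithTop Λ) : Λ →. P :=
  PFun.res p (itv x₁ x₂)

/-- Two partial paths are equal exactly if they have the same domain and the same values on it. -/
theorem seg_eq_seg_iff (p q : Λ → P) (x₁ y₁ : WithBot Λ) (x₂ y₂ : WithTop Λ) :
    seg p x₁ x₂ = seg q y₁ y₂ ↔
      itv x₁ x₂ = itv y₁ y₂ ∧ ∀ l ∈ itv x₁ x₂, p l = q l := by
  constructor
  · intro h
    have key : ∀ l b, (l ∈ itv x₁ x₂ ∧ p l = b) ↔ (l ∈ itv y₁ y₂ ∧ q l = b) := by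
      intro l b
      have h2 : b ∈ seg p x₁ x₂ l ↔ b ∈ seg q y₁ y₂ l := by rw [h]
      simpa [seg, PFun.mem_res] using h2
    refine ⟨?_, fun l hl => ((key l (p l)).1 ⟨hl, rfl⟩).2.symm⟩
    ext l
    exact ⟨fun hl => ((key l (p l)).1 ⟨hl, rfl⟩).1, fun hl => ((key l (q l)).2 ⟨hl, rfl⟩).1⟩
  · rintro ⟨h1, h2⟩
    apply PFun.ext
    intro l b
    simp only [seg, PFun.mem_res, ← h1]
    constructor
    · rintro ⟨hl, rfl⟩
      exact ⟨hl, (h2 l hl).symm⟩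
    · rintro ⟨hl, rfl⟩
      exact ⟨hl, h2 l hl⟩

/-- `S[x₁, x₂]`, the set of all `p[x₁, x₂]` with `p ∈ S`. -/
def segs (S : Set (Λ → P)) (x₁ : WithBot Λ) (x₂ : WithTop Λ) : Set (Λ →. P) :=
  {g | ∃ p ∈ S, g = seg p x₁ x₂}

/-- The function that equals `f` up to `l` and `g` after `l`, so that for `f l = g l` the partial
path `f[x₁, l] ∘ g[l, x₂]` is `(glue l f g)[x₁, x₂]`. -/
def glue (l : Λ) (f g : Λ → P) : Λ → P := fun t => if t ≤ l then f t else g t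

/-- Concatenation `A ∘ B` of sets of partial paths. -/
def concat (A B : Set (Λ →. P)) : Set (Λ →. P) :=
  {h | ∃ (x₁ : WithBot Λ) (l : Λ) (x₂ : WithTop Λ) (f g : Λ → P),
    x₁ ≤ (l : WithBot Λ) ∧ (l : WithTop Λ) ≤ x₂ ∧
    seg f x₁ l ∈ A ∧ seg g l x₂ ∈ B ∧ f l = g l ∧ h = seg (glue l f g) x₁ x₂}

/-! ### Dynamic sets and dynamic spaces -/

/-- A dynamic set: a non-empty set of paths with a common parameter. -/
def IsDynamicSet (S : Set (Λ → P)) : Prop := S.Nonempty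

/-- `𝒫_S`, the set of states of `S`. -/
def states (S : Set (Λ → P)) : Set P := {x | ∃ p ∈ S, ∃ l, p l = x}

/-- `S(l)`, the set of states that are possible at `l`. -/
def statesAt (S : Set (Λ → P)) (l : Λ) : Set P := {x | ∃ p ∈ S, p l = x}

/-- A dynamic space: a dynamic set that is closed under concatenation. -/
def IsDynamicSpace (D : Set (Λ → P)) : Prop :=
  IsDynamicSet D ∧ ∀ p ∈ D, ∀ q ∈ D, ∀ l, p l = q l → glue l p q ∈ D

/-- Homogeneity: the paths through `x` at `l₁` are the paths through `x` at `l₂` shifted by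
`d = l₂ - l₁`, for all `l₁ ≤ l₂` at which `x` is possible. -/
def IsHomogeneous [AddCommMonoid Λ] (S : Set (Λ → P)) : Prop :=
  ∀ (l₁ l₂ d : Λ) (x : P), x ∈ statesAt S l₁ → x ∈ statesAt S l₂ → l₁ ≤ l₂ → l₁ + d = l₂ →
    ∀ p : Λ → P, (p ∈ S ∧ p l₁ = x) ↔ ∃ q ∈ S, q l₂ = x ∧ ∀ l, p l = q (l + d)

/-- Every element of `A` is possible at every time. -/
def IsHomogeneouslyRealized (S : Set (Λ → P)) (A : Set P) : Prop :=
  ∀ x ∈ A, ∀ l, x ∈ statesAt S l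

/-- `S_{X→}`. -/
def pathsFrom (S : Set (Λ → P)) (X : Set P) : Set (Λ →. P) :=
  {g | ∃ p ∈ S, ∃ l : Λ, p l ∈ X ∧ g = seg p l ⊤}

/-- `S_{→Y}`. -/
def pathsTo (S : Set (Λ → P)) (Y : Set P) : Set (Λ →. P) :=
  {g | ∃ p ∈ S, ∃ l : Λ, p l ∈ Y ∧ g = seg p ⊥ l}

/-- `S_{X→Y↾W}`: segments from `X` to `Y` that are not in `W` before their end. -/
def fromToBefore (S : Set (Λ → P)) (X Y W : Set P) : Set (Λ →. P) :=
  {g | ∃ p ∈ S, ∃ l₁ l₂ : Λ, l₁ ≤ l₂ ∧ p l₁ ∈ X ∧ p l₂ ∈ Y ∧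
    (∀ l, l₁ ≤ l → l < l₂ → p l ∉ W) ∧ g = seg p l₁ l₂}

/-- `S_{W↿X→Y}`: segments from `X` to `Y` that are not in `W` after their start. -/
def afterFromTo (S : Set (Λ → P)) (W X Y : Set P) : Set (Λ →. P) :=
  {g | ∃ p ∈ S, ∃ l₁ l₂ : Λ, l₁ ≤ l₂ ∧ p l₁ ∈ X ∧ p l₂ ∈ Y ∧
    (∀ l, l₁ < l → l ≤ l₂ → p l ∉ W) ∧ g = seg p l₁ l₂}

/-- `S_{X/Y}`: segments `p[l₁, l₂]` that start in `X`, where `p[l₁, ∞]` meets `Y` and `l₂` is the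
greatest lower bound of the times in `[l₁, ∞]` at which `p` is in `Y`. -/
def upToFirst (S : Set (Λ → P)) (X Y : Set P) : Set (Λ →. P) :=
  {g | ∃ p ∈ S, ∃ l₁ l₂ : Λ, p l₁ ∈ X ∧ {l | l₁ ≤ l ∧ p l ∈ Y}.Nonempty ∧
    IsGLB {l | l₁ ≤ l ∧ p l ∈ Y} l₂ ∧ g = seg p l₁ l₂}

/-- `A→` in a dynamic space `D`: the `p[x, ∞] ∈ D[x, ∞]` with some `p[x, x₁] ∈ A`. -/
def extendRight (D : Set (Λ → P)) (A : Set (Λ →. P)) : Set (Λ →. P) :=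
  {g | ∃ p ∈ D, ∃ x x₁ : Λ, x ≤ x₁ ∧ seg p x x₁ ∈ A ∧ g = seg p x ⊤}

/-- `→A` in a dynamic space `D`: the `p[-∞, x] ∈ D[-∞, x]` with some `p[x₀, x] ∈ A`. -/
def extendLeft (D : Set (Λ → P)) (A : Set (Λ →. P)) : Set (Λ →. P) :=
  {g | ∃ p ∈ D, ∃ x₀ x : Λ, x₀ ≤ x ∧ seg p x₀ x ∈ A ∧ g = seg p ⊥ x}

/-- `→A→` in a dynamic set `S`: the paths in `S[-∞, x₁] ∘ p'[x₁, x₂] ∘ S[x₂, ∞]` for some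
`p'[x₁, x₂] ∈ A`; they need not be in `S`. If the elements of `A` are of the form `p'[x₁, ∞]`,
this is `→A`, and if they are of the form `p'[-∞, x₂]`, this is `A→`. -/
def arrow (S : Set (Λ → P)) (A : Set (Λ →. P)) : Set (Λ → P) :=
  {q | ∃ (x₁ : WithBot Λ) (x₂ : WithTop Λ), seg q x₁ x₂ ∈ A ∧
    (∃ f ∈ S, ∀ l : Λ, (l : WithBot Λ) ≤ x₁ → q l = f l) ∧
    (∃ g ∈ S, ∀ l : Λ, x₂ ≤ (l : WithTop Λ) → q l = g l)}

/-- `+A = (→A→) ∩ S`, and likewise for the one-sided versions. -/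
def plus (S : Set (Λ → P)) (A : Set (Λ →. P)) : Set (Λ → P) := arrow S A ∩ S

/-! ### Ideal partitions -/

/-- `|A|ₙ` for the family `𝓑`: `|A|₀ = A`, and `|A|ₙ₊₁` is the union of all `B ∈ 𝓑` that
intersect `|A|ₙ`. -/
def chainStep {X : Type*} (𝓑 : Set (Set X)) (A : Set X) : ℕ → Set X
  | 0 => A
  | n + 1 => {x | ∃ B ∈ 𝓑, (B ∩ chainStep 𝓑 A n).Nonempty ∧ x ∈ B}

/-- `|A| = ⋃ₙ |A|ₙ`. -/
def chain {X : Type*} (𝓑 : Set (Set X)) (A : Set X) : Set X := ⋃ n, chainStep 𝓑 A n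

/-- `|α[x, l]|` relative to the covering `K`. -/
def cls (K : Set (Set (Λ → P))) (α : Set (Λ → P)) (x : WithBot Λ) (l : Λ) : Set (Λ →. P) :=
  chain {B | ∃ β ∈ K, B = segs β x l} (segs α x l)

/-- `α ⊆ S` is strongly bounded from below by `l`: `α = →α[l', ∞]` for all `l' ≤ l`. -/
def StronglyBoundedBelow (S α : Set (Λ → P)) (l : Λ) : Prop :=
  ∀ l' : Λ, l' ≤ l → α = arrow S (segs α l' ⊤)

/-- `α ⊆ S` is weakly bounded from above by `l`: `α = α[-∞, l]⇁`. -/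
def WeaklyBoundedAbove (S α : Set (Λ → P)) (l : Λ) : Prop :=
  α = plus S (segs α ⊥ l)

/-- A partition of `S` into non-empty sets. -/
def IsPartition (S : Set (Λ → P)) (γ : Set (Set (Λ → P))) : Prop :=
  ⋃₀ γ = S ∧ γ.PairwiseDisjoint id ∧ ∅ ∉ γ

/-- An ideal partition of the dynamic set `S`. The bound from below is common to all `α ∈ γ`, the
bound from above is not. -/
structure IsIdealPartition (S : Set (Λ → P)) (γ : Set (Set (Λ → P))) : Prop where
  partition : IsPartition S γ
  below : ∃ l : Λ, ∀ α ∈ γ, StronglyBoundedBelow S α l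
  above : ∀ α ∈ γ, ∃ l : Λ, WeaklyBoundedAbove S α l
  eq_concat : ∀ α ∈ γ, ∀ l : Λ, segs α ⊥ ⊤ = concat (cls γ α ⊥ l) (segs α l ⊤)

/-- `S` is unbiased with respect to `(l, K)`. -/
def IsUnbiasedFor (S : Set (Λ → P)) (l : Λ) (K : Set (Set (Λ → P))) : Prop :=
  StronglyBoundedBelow S S l ∧
  ∀ a ∈ K, ∀ l' : Λ, l < l' → ∀ p ∈ plus S (cls K a ⊥ l'), ∀ q ∈ plus S (cls K a ⊥ l'),
    p l' = q l' → glue l' p q ∈ S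

end Paths

/-! ### Shells -/

section Shells

variable {Λ : Type u} [AddCommMonoid Λ] [LinearOrder Λ] {P : Type v}

/-- A shell `(D, I, F)`. -/
structure IsShell (D : Set (Λ → P)) (I F : Set P) : Prop where
  isDynamicSpace : IsDynamicSpace D
  initial_subset : I ⊆ states D
  final_subset : F ⊆ states D
  homogeneous : IsHomogeneous D
  realized : IsHomogeneouslyRealized D I
  from_initial : pathsFrom D I = extendRight D (afterFromTo D I I F)
  to_final : pathsTo D F = extendLeft D (afterFromTo D I I F)

/-- The shell interior. -/
def shellInt (D : Set (Λ → P)) (I F : Set P) : Set P :=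
  {x ∈ states D | (fromToBefore D I {x} F).Nonempty}

/-- The shell domain. -/
def shellDom (D : Set (Λ → P)) (I F : Set P) : Set P := F ∪ shellInt D I F

end Shells

/-- An environmental shell with system states in `σ` and environmental states in `ε`. All states
of the closed system are taken to be pairs; this costs no generality, as a state outside the shell
domain can be coded as a pair whose second entry is not used elsewhere. -/
structure EnvShell (Λ : Type u) [AddCommMonoid Λ] [LinearOrder Λ] (σ : Type v) (ε : Type w) where
  D : Set (Λ → σ × ε)
  I : Set (σ × ε)
  F : Set (σ × ε)
  isShell : IsShell D I F
  /-- the system -/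
  sys : Set σ
  /-- the environmental states of the interior -/
  envInt : Set ε
  /-- the environmental states of the final states -/
  envF : Set ε
  int_eq : (sys ×ˢ envInt) ∩ states D = shellInt D I F
  final_eq : (sys ×ˢ envF) ∩ states D = F
  sys_eq : sys = Prod.fst '' shellDom D I F
  envInt_eq : envInt = Prod.snd '' shellInt D I F
  envF_eq : envF = Prod.snd '' F

namespace EnvShell

variable {Λ : Type u} [AddCommMonoid Λ] [LinearOrder Λ] {σ : Type v} {ε : Type w}

/-- `A·𝒮`, the system components of a set of path segments. -/
def sysPart (A : Set (Λ →. σ × ε)) : Set (Λ →. σ) := (fun g => PFun.map Prod.fst g) '' A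

/-- `A·ℰ`, the environmental components of a set of path segments. -/
def envPart (A : Set (Λ →. σ × ε)) : Set (Λ →. ε) := (fun g => PFun.map Prod.snd g) '' A

/-- `ω_A`, the `p[0, l] ∈ I↿I→A`. -/
def runs (Z : EnvShell Λ σ ε) (A : Set (σ × ε)) : Set (Λ →. σ × ε) :=
  {g | ∃ (p : Λ → σ × ε) (l : Λ), 0 ≤ l ∧ seg p (0 : Λ) l ∈ afterFromTo Z.D Z.I Z.I A ∧
    g = seg p (0 : Λ) l}

/-- `Θ_A^l`, the `p[l, l'] ∈ D_{I/F}` that are initial segments of some `p'[l, l''] ∈ I↿I→A`. -/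
def theta (Z : EnvShell Λ σ ε) (l : Λ) (A : Set (σ × ε)) : Set (Λ →. σ × ε) :=
  {g | ∃ (p : Λ → σ × ε) (l' : Λ), l ≤ l' ∧ seg p l l' ∈ upToFirst Z.D Z.I Z.F ∧
    (∃ (p' : Λ → σ × ε) (l'' : Λ), l' ≤ l'' ∧ seg p' l l'' ∈ afterFromTo Z.D Z.I Z.I A ∧
      seg p' l l' = seg p l l') ∧
    g = seg p l l'}

/-- `𝒪_X^l`; the outcome `𝒪_X` is the case `l = 0`. -/
def outcome (Z : EnvShell Λ σ ε) (l : Λ) (X : Set ε) : Set (Λ →. σ) :=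
  sysPart (Z.theta l (Z.sys ×ˢ X))

/-- `Σ_A`. -/
def sigmaTo (Z : EnvShell Λ σ ε) (A : Set (σ × ε)) : Set (Λ →. σ) :=
  {g | ∃ (p : Λ → σ × ε) (l₁ l₂ : Λ), 0 ≤ l₁ ∧ l₁ ≤ l₂ ∧ seg p (0 : Λ) l₂ ∈ Z.theta 0 Z.F ∧
    p l₁ ∈ A ∧ g = seg (fun l => (p l).1) (0 : Λ) l₁}

/-- `Σ_{A→}`. -/
def sigmaFrom (Z : EnvShell Λ σ ε) (A : Set (σ × ε)) : Set (Λ →. σ) :=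
  {g | ∃ (p : Λ → σ × ε) (l₁ l₂ : Λ), 0 ≤ l₁ ∧ l₁ ≤ l₂ ∧ seg p (0 : Λ) l₂ ∈ Z.theta 0 Z.F ∧
    p l₁ ∈ A ∧ g = seg (fun l => (p l).1) l₁ l₂}

/-- `Θ_F(l)`. -/
def thetaStatesAt (Z : EnvShell Λ σ ε) (l : Λ) : Set (σ × ε) :=
  {x | ∃ (p : Λ → σ × ε) (l₂ : Λ), 0 ≤ l ∧ l ≤ l₂ ∧ seg p (0 : Λ) l₂ ∈ Z.theta 0 Z.F ∧ p l = x}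

/-- The automata condition. -/
def AutomataCondition (Z : EnvShell Λ σ ε) : Prop :=
  ∀ (s₁ s₂ : Λ → σ) (l₁ l₂ : Λ), seg s₁ (0 : Λ) l₁ ∈ Z.outcome 0 Z.envF →
    seg s₂ (0 : Λ) l₂ ∈ Z.outcome 0 Z.envF → l₁ < l₂ → seg s₁ (0 : Λ) l₁ ≠ seg s₂ (0 : Λ) l₁

/-- `𝒪_e[0, l]`, the `s[0, l]` with `s[0, l'] ∈ 𝒪_e` for some `l' ≥ l`. -/
def outcomeUpTo (Z : EnvShell Λ σ ε) (e : ε) (l : Λ) : Set (Λ →. σ) :=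
  {g | ∃ (s : Λ → σ) (l' : Λ), 0 ≤ l ∧ l ≤ l' ∧ seg s (0 : Λ) l' ∈ Z.outcome 0 {e} ∧
    g = seg s (0 : Λ) l}

/-- `|𝒪_e[0, l]|`. -/
def outcomeCls (Z : EnvShell Λ σ ε) (e : ε) (l : Λ) : Set (Λ →. σ) :=
  chain {B | ∃ e' ∈ Z.envF, B = Z.outcomeUpTo e' l} (Z.outcomeUpTo e l)

/-- Undifferentiated states of the shell interior. -/
def Undifferentiated (Z : EnvShell Λ σ ε) (x y : σ × ε) : Prop :=
  x ∈ shellInt Z.D Z.I Z.F ∧ y ∈ shellInt Z.D Z.I Z.F ∧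
  ∃ e ∈ Z.envF, ∃ l : Λ, 0 ≤ l ∧ (Z.sigmaTo {x} ∩ Z.outcomeCls e l).Nonempty ∧
    (Z.sigmaTo {y} ∩ Z.outcomeCls e l).Nonempty

/-- Every segment of `A` that starts at `l` agrees with some segment of `B` that starts at `l` for
as long as both of them last. -/
def Follows (l : Λ) (A B : Set (Λ →. σ)) : Prop :=
  ∀ (s₁ : Λ → σ) (l₁ : Λ), l ≤ l₁ → seg s₁ l l₁ ∈ A →
    ∃ (s₂ : Λ → σ) (l₂ : Λ), l ≤ l₂ ∧ seg s₂ l l₂ ∈ B ∧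
      seg s₁ l (min l₁ l₂ : Λ) = seg s₂ l (min l₁ l₂ : Λ)

/-- The weak unbiased condition. -/
def WeaklyUnbiased (Z : EnvShell Λ σ ε) : Prop :=
  ∀ (l : Λ) (s : σ) (e₁ e₂ : ε), (s, e₁) ∈ Z.thetaStatesAt l → (s, e₂) ∈ Z.thetaStatesAt l →
    Z.Undifferentiated (s, e₁) (s, e₂) →
    Follows l (Z.sigmaFrom {(s, e₁)}) (Z.sigmaFrom {(s, e₂)}) ∧
    Follows l (Z.sigmaFrom {(s, e₂)}) (Z.sigmaFrom {(s, e₁)})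

/-- An e-automaton. -/
def IsEAutomaton (Z : EnvShell Λ σ ε) : Prop := Z.WeaklyUnbiased ∧ Z.AutomataCondition

/-- Boolean: distinct outcomes are disjoint. -/
def IsBoolean (Z : EnvShell Λ σ ε) : Prop :=
  ∀ e ∈ Z.envF, ∀ e' ∈ Z.envF,
    Z.outcome 0 {e} = Z.outcome 0 {e'} ∨ Z.outcome 0 {e} ∩ Z.outcome 0 {e'} = ∅

/-- `ω_{ē[0, l]}`. -/
def runsAlong (Z : EnvShell Λ σ ε) (ē : Λ → ε) (l : Λ) : Set (Λ →. σ × ε) :=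
  {g ∈ Z.runs (shellDom Z.D Z.I Z.F) | PFun.map Prod.snd g = seg ē (0 : Λ) l}

/-- `Θ_{ē[0, l]}`. -/
def thetaAlong (Z : EnvShell Λ σ ε) (ē : Λ → ε) (l : Λ) : Set (Λ →. σ × ε) :=
  {g | ∃ (p : Λ → σ × ε) (l' : Λ), l' ≤ l ∧ seg p (0 : Λ) l' ∈ Z.theta 0 Z.F ∧
    (∃ p' : Λ → σ × ε, seg p' (0 : Λ) l ∈ Z.runsAlong ē l ∧
      seg p' (0 : Λ) l' = seg p (0 : Λ) l') ∧
    g = seg p (0 : Λ) l'}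

/-- `𝒪_{ē[0, l]}`. -/
def outcomeAlong (Z : EnvShell Λ σ ε) (ē : Λ → ε) (l : Λ) : Set (Λ →. σ) :=
  sysPart (Z.thetaAlong ē l)

/-- `e` is reet: `𝒪_{ē[0, l]} = 𝒪_e` for all `ē[0, l] ∈ ω_e·ℰ`. -/
def IsReet (Z : EnvShell Λ σ ε) (e : ε) : Prop :=
  ∀ (ē : Λ → ε) (l : Λ), seg ē (0 : Λ) l ∈ envPart (Z.runs (Z.sys ×ˢ {e})) →
    Z.outcomeAlong ē l = Z.outcome 0 {e}

/-- All-reet. -/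
def IsAllReet (Z : EnvShell Λ σ ε) : Prop := ∀ e ∈ Z.envF, Z.IsReet e

/-- An ideal e-automaton. -/
def IsIdeal (Z : EnvShell Λ σ ε) : Prop := Z.IsEAutomaton ∧ Z.IsBoolean ∧ Z.IsAllReet

/-- `Z` decides the covering `K` of the dynamic set `S`. -/
def Decides (Z : EnvShell Λ σ ε) (S : Set (Λ → σ)) (K : Set (Set (Λ → σ))) : Prop :=
  ⋃₀ K = S ∧
  ∃ l : Λ,
    (∀ (s : Λ → σ) (l' : Λ), l ≤ l' → seg s l l' ∈ Z.outcome l Z.envF →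
      seg s l l' ∈ segs S l l') ∧
    IsUnbiasedFor S l K ∧
    K = {α | ∃ e ∈ Z.envF, α = plus S (Z.outcome l {e})}

end EnvShell

end Dyn

set_option linter.unusedSectionVars false

/-! The environment is built to carry a clock and exactly as much information about the cell as the
system has shown. Fix a common lower bound `l` of the cells. For `s ∈ α ∈ γ` and a start `τ`, the
closed system idles in `(p₀, none)` before `τ`; at elapsed time `k` it is in `s (l + k)`, paired
with `k` and the class `|α[-∞, l + k]|`. The experiment ends at an elapsed time `m α` so late that
the class singles out `α`.

Three facts carry the proof. By the bound from below, the class at `l + k` depends only on the path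
between `l` and `l + k` (`cls_eq_of_agreeOn`), so equal system histories give equal records. By the
third condition on ideal partitions, a path may be continued by any path of the same class that it
meets (`glue_mem`), so these paths form a dynamic space. By the bound from above, the class of a
cell eventually contains no other cell (`eq_of_cls_eq`), so `m α` exists.

The clock makes every experiment meet the initial and the final states exactly once, which gives the
shell conditions. The outcome of the verdict for `α` is `α` observed for the time `m α`; a system
segment or an environmental record of that length identifies the cell. This yields the conditions on
an ideal e-automaton and the recovery of `γ`. -/

namespace Dyn

/-! ### Chains of intersecting sets -/

section Chains

variable {X : Type*} {𝓑 : Set (Set X)} {A B T : Set X}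

theorem subset_chain (𝓑 : Set (Set X)) (A : Set X) : A ⊆ chain 𝓑 A :=
  fun _ hx => Set.mem_iUnion.2 ⟨0, hx⟩

theorem subset_chain_of_inter_nonempty (hB : B ∈ 𝓑) (h : (B ∩ chain 𝓑 A).Nonempty) :
    B ⊆ chain 𝓑 A := by
  obtain ⟨x, hxB, hx⟩ := h
  obtain ⟨n, hn⟩ := Set.mem_iUnion.1 hx
  exact fun y hy => Set.mem_iUnion.2 ⟨n + 1, B, hB, ⟨x, hxB, hn⟩, hy⟩

theorem chain_subset (hA : A ⊆ T) (hT : ∀ B ∈ 𝓑, (B ∩ T).Nonempty → B ⊆ T) :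
    chain 𝓑 A ⊆ T := by
  refine Set.iUnion_subset fun n => ?_
  induction n with
  | zero => exact hA
  | succ n ih =>
    rintro x ⟨B, hB, ⟨y, hyB, hy⟩, hx⟩
    exact hT B hB ⟨y, hyB, ih hy⟩ hx

/-- Being linked by a chain is symmetric: the complement of `chain 𝓑 B` absorbs every member of `𝓑`
that meets it, so if `A` lay in this complement, all of `chain 𝓑 A` would, although it meets `B`. -/
theorem chain_eq_of_inter_nonempty (hA : A ∈ 𝓑) (hB : B ∈ 𝓑) (h : (B ∩ chain 𝓑 A).Nonempty) :
    chain 𝓑 B = chain 𝓑 A := by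
  refine (chain_subset (subset_chain_of_inter_nonempty hB h)
    fun _ => subset_chain_of_inter_nonempty).antisymm
    (chain_subset (subset_chain_of_inter_nonempty hA ?_) fun _ => subset_chain_of_inter_nonempty)
  by_contra hne
  obtain ⟨x, hxB, hx⟩ := h
  have hsub : chain 𝓑 A ⊆ (chain 𝓑 B)ᶜ := by
    refine chain_subset (fun y hyA hyB => hne ⟨y, hyA, hyB⟩) ?_
    rintro C hC ⟨y, hyC, hy⟩ z hzC hz
    exact hy (subset_chain_of_inter_nonempty hC ⟨z, hzC, hz⟩ hyC)
  exact hsub hx (subset_chain 𝓑 B hxB)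

end Chains

/-! ### Equality of path segments -/

section Segments

variable {Λ : Type u} [LinearOrder Λ] {P : Type v}

@[simp] theorem mem_itv_coe {x y t : Λ} : t ∈ itv (x : WithBot Λ) (y : WithTop Λ) ↔ x ≤ t ∧ t ≤ y := by
  simp [itv]

@[simp] theorem mem_itv_bot {y t : Λ} : t ∈ itv (⊥ : WithBot Λ) (y : WithTop Λ) ↔ t ≤ y := by
  simp [itv]

@[simp] theorem mem_itv_top {x t : Λ} : t ∈ itv (x : WithBot Λ) (⊤ : WithTop Λ) ↔ x ≤ t := by
  simp [itv]

theorem seg_coe_eq_iff {p q : Λ → P} {x y x' y' : Λ} (h : x ≤ y) (h' : x' ≤ y') :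
    seg p x y = seg q x' y' ↔ x = x' ∧ y = y' ∧ ∀ t, x ≤ t → t ≤ y → p t = q t := by
  rw [seg_eq_seg_iff]
  constructor
  · rintro ⟨h1, h2⟩
    have e (t : Λ) : (x ≤ t ∧ t ≤ y) ↔ (x' ≤ t ∧ t ≤ y') := by
      simpa using Set.ext_iff.1 h1 t
    have hx := (e x).1 ⟨le_rfl, h⟩
    have hy := (e y).1 ⟨h, le_rfl⟩
    have hx' := (e x').2 ⟨le_rfl, h'⟩
    have hy' := (e y').2 ⟨h', le_rfl⟩
    exact ⟨hx'.1.antisymm hx.1, hy.2.antisymm hy'.2, fun t h1 h3 => h2 t (mem_itv_coe.2 ⟨h1, h3⟩)⟩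
  · rintro ⟨rfl, rfl, h2⟩
    exact ⟨rfl, fun t ht => h2 t (mem_itv_coe.1 ht).1 (mem_itv_coe.1 ht).2⟩

theorem seg_bot_eq_iff {p q : Λ → P} {y : Λ} :
    seg p ⊥ y = seg q ⊥ y ↔ ∀ t ≤ y, p t = q t := by
  simp [seg_eq_seg_iff]

theorem seg_top_eq_iff {p q : Λ → P} {x : Λ} :
    seg p x ⊤ = seg q x ⊤ ↔ ∀ t, x ≤ t → p t = q t := by
  simp [seg_eq_seg_iff]

theorem map_seg {Q : Type*} (f : P → Q) (p : Λ → P) (x : WithBot Λ) (y : WithTop Λ) :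
    PFun.map f (seg p x y) = seg (fun t => f (p t)) x y := by
  apply PFun.ext
  intro t b
  have h : b ∈ PFun.map f (seg p x y) t ↔ ∃ a ∈ seg p x y t, f a = b := Part.mem_map_iff f
  rw [h]
  simp [seg, PFun.mem_res]

end Segments

/-! ### Classes of an ideal partition -/

section Classes

variable {Λ : Type u} [LinearOrder Λ] {P : Type v} {S α β : Set (Λ → P)} {γ : Set (Set (Λ → P))}

theorem cls_eq_of_mem {l : Λ} (hα : α ∈ γ) (hβ : β ∈ γ) {s : Λ → P} (hs : s ∈ β)
    (h : seg s ⊥ l ∈ cls γ α ⊥ l) : cls γ β ⊥ l = cls γ α ⊥ l :=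
  chain_eq_of_inter_nonempty ⟨α, hα, rfl⟩ ⟨β, hβ, rfl⟩ ⟨_, ⟨s, hs, rfl⟩, h⟩

theorem seg_mem_cls {l : Λ} {s : Λ → P} (hs : s ∈ α) : seg s ⊥ l ∈ cls γ α ⊥ l :=
  subset_chain _ _ ⟨s, hs, rfl⟩

theorem cls_eq_of_agree {l : Λ} (hα : α ∈ γ) (hβ : β ∈ γ) {s s' : Λ → P} (hs : s ∈ α)
    (hs' : s' ∈ β) (h : ∀ t ≤ l, s t = s' t) : cls γ α ⊥ l = cls γ β ⊥ l :=
  cls_eq_of_mem hβ hα hs (seg_bot_eq_iff.2 h ▸ seg_mem_cls hs')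

theorem exists_of_mem_cls {l : Λ} {g : Λ →. P} (hg : g ∈ cls γ α ⊥ l) :
    ∃ p, g = seg p ⊥ l := by
  have : cls γ α ⊥ l ⊆ {g | ∃ p, g = seg p ⊥ l} := by
    refine chain_subset ?_ ?_
    · rintro _ ⟨p, -, rfl⟩
      exact ⟨p, rfl⟩
    · rintro _ ⟨β, -, rfl⟩ - _ ⟨p, -, rfl⟩
      exact ⟨p, rfl⟩
  exact this hg

/-- Restriction to `[-∞, k]` turns a chain at `m` into a chain at `k`, so classes only get finer
with time. -/
theorem cls_eq_mono (hα : α ∈ γ) (hβ : β ∈ γ) (hne : β.Nonempty) {k m : Λ} (hkm : k ≤ m)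
    (h : cls γ α ⊥ m = cls γ β ⊥ m) : cls γ α ⊥ k = cls γ β ⊥ k := by
  have hsub : cls γ α ⊥ m ⊆ {g | ∀ p, g = seg p ⊥ m → seg p ⊥ k ∈ cls γ α ⊥ k} := by
    refine chain_subset ?_ ?_
    · rintro _ ⟨q, hq, rfl⟩ p hp
      rw [← seg_bot_eq_iff.2 fun t ht => seg_bot_eq_iff.1 hp t (ht.trans hkm)]
      exact seg_mem_cls hq
    · rintro _ ⟨δ, hδ, rfl⟩ ⟨_, ⟨q, hq, rfl⟩, hT⟩ _ ⟨r, hr, rfl⟩ p hp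
      rw [← seg_bot_eq_iff.2 fun t ht => seg_bot_eq_iff.1 hp t (ht.trans hkm)]
      rw [← cls_eq_of_mem hα hδ hq (hT q rfl)]
      exact seg_mem_cls hr
  obtain ⟨b, hb⟩ := hne
  exact (cls_eq_of_mem hα hβ hb (hsub (h ▸ seg_mem_cls hb) b rfl)).symm

namespace IsIdealPartition

theorem nonempty (hγ : IsIdealPartition S γ) (hα : α ∈ γ) : α.Nonempty :=
  Set.nonempty_iff_ne_empty.2 fun h => hγ.partition.2.2 (h ▸ hα)

theorem subset (hγ : IsIdealPartition S γ) (hα : α ∈ γ) : α ⊆ S := by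
  rw [← hγ.partition.1]
  exact Set.subset_sUnion_of_mem hα

theorem exists_mem (hγ : IsIdealPartition S γ) {s : Λ → P} (hs : s ∈ S) : ∃ α ∈ γ, s ∈ α := by
  rwa [← hγ.partition.1] at hs

theorem eq_of_mem (hγ : IsIdealPartition S γ) (hα : α ∈ γ) (hβ : β ∈ γ) {s : Λ → P}
    (hs : s ∈ α) (hs' : s ∈ β) : α = β :=
  hγ.partition.2.1.elim hα hβ (Set.not_disjoint_iff.2 ⟨s, hs, hs'⟩)

/-- The third condition allows any history from the class of `β` before a future from `β`, and the
histories of `α` belong to that class. -/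
theorem glue_mem (hγ : IsIdealPartition S γ) (hβ : β ∈ γ) {l : Λ}
    (h : cls γ α ⊥ l = cls γ β ⊥ l) {s s' : Λ → P} (hs : s ∈ α) (hs' : s' ∈ β)
    (hl : s l = s' l) : glue l s s' ∈ β := by
  have hmem : seg (glue l s s') ⊥ ⊤ ∈ segs β ⊥ ⊤ := by
    rw [hγ.eq_concat β hβ l]
    exact ⟨⊥, l, ⊤, s, s', bot_le, le_top, h ▸ seg_mem_cls hs, ⟨s', hs', rfl⟩, hl, rfl⟩
  obtain ⟨p, hp, hpe⟩ := hmem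
  have : glue l s s' = p := funext fun t => ((seg_eq_seg_iff _ _ _ _ _ _).1 hpe).2 t (by simp [itv])
  exact this ▸ hp

/-- What happens before `l` is irrelevant: strong boundedness lets the history of `s` replace that
of `s'` without leaving `β`, and the result agrees with `s` up to `m`. -/
theorem cls_eq_of_agreeOn (hγ : IsIdealPartition S γ) {l m : Λ}
    (hl : ∀ α ∈ γ, StronglyBoundedBelow S α l) (hlm : l ≤ m) (hα : α ∈ γ) (hβ : β ∈ γ)
    {s s' : Λ → P} (hs : s ∈ α) (hs' : s' ∈ β) (h : ∀ t, l ≤ t → t ≤ m → s t = s' t) :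
    cls γ α ⊥ m = cls γ β ⊥ m := by
  have hg : glue l s s' ∈ β := by
    rw [hl β hβ l le_rfl]
    refine ⟨l, ⊤, ⟨s', hs', seg_top_eq_iff.2 ?_⟩, ⟨s, hγ.subset hα hs, ?_⟩,
      ⟨s, hγ.subset hα hs, by simp⟩⟩
    · intro t ht
      rcases ht.eq_or_lt with rfl | ht
      · simpa [glue] using h l le_rfl hlm
      · simp [glue, ht.not_ge]
    · intro t ht
      simp [glue, WithBot.coe_le_coe.1 ht]
  refine cls_eq_of_agree hα hβ hs hg fun t ht => ?_
  by_cases htl : t ≤ l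
  · simp [glue, htl]
  · simp only [glue, htl, if_false]
    exact h t (not_le.1 htl).le ht

/-- At its upper bound the class of `α` is just `α[-∞, l]`: a cell with a path that agrees up to `l`
with one of `α` meets `α`, hence equals it, so the chain never grows. Later classes are finer still.
-/
theorem eq_of_cls_eq (hγ : IsIdealPartition S γ) (hα : α ∈ γ) (hβ : β ∈ γ) {l m : Λ}
    (hl : WeaklyBoundedAbove S α l) (hlm : l ≤ m) (h : cls γ β ⊥ m = cls γ α ⊥ m) : β = α := by
  have key : ∀ δ ∈ γ, ∀ q ∈ δ, ∀ s ∈ α, (∀ t ≤ l, q t = s t) → δ = α := by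
    intro δ hδ q hq s hs hqs
    refine hγ.eq_of_mem hδ hα hq ?_
    rw [hl]
    have hqS := hγ.subset hδ hq
    exact ⟨⟨⊥, l, ⟨s, hs, seg_bot_eq_iff.2 hqs⟩, ⟨q, hqS, fun _ _ => rfl⟩,
      ⟨q, hqS, fun _ _ => rfl⟩⟩, hqS⟩
  replace h := cls_eq_mono hβ hα (hγ.nonempty hα) hlm h
  have hsub : cls γ α ⊥ l ⊆ segs α ⊥ l := by
    refine chain_subset subset_rfl ?_
    rintro _ ⟨δ, hδ, rfl⟩ ⟨_, ⟨q, hq, rfl⟩, s, hs, hqs⟩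
    rw [key δ hδ q hq s hs (seg_bot_eq_iff.1 hqs)]
  obtain ⟨b, hb⟩ := hγ.nonempty hβ
  obtain ⟨s, hs, hbs⟩ := hsub (h ▸ seg_mem_cls hb)
  exact key β hβ b hb s hs (seg_bot_eq_iff.1 hbs)

theorem isUnbiasedFor (hγ : IsIdealPartition S γ) {l : Λ}
    (hl : ∀ α ∈ γ, StronglyBoundedBelow S α l) : IsUnbiasedFor S l γ := by
  refine ⟨fun l' hl' => Set.Subset.antisymm ?_ ?_, ?_⟩
  · intro s hs
    exact ⟨l', ⊤, ⟨s, hs, rfl⟩, ⟨s, hs, fun _ _ => rfl⟩, ⟨s, hs, fun _ _ => rfl⟩⟩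
  · rintro q ⟨x₁, x₂, ⟨p, hp, hqp⟩, hf, hg⟩
    obtain ⟨α, hα, hpα⟩ := hγ.exists_mem hp
    refine hγ.subset hα ?_
    rw [hl α hα l' hl']
    exact ⟨x₁, x₂, ⟨p, hpα, hqp⟩, hf, hg⟩
  · intro a ha l' _ p hp q hq hpq
    have key : ∀ p ∈ plus S (cls γ a ⊥ l'), ∃ α ∈ γ, p ∈ α ∧ cls γ α ⊥ l' = cls γ a ⊥ l' := by
      rintro p ⟨⟨x₁, x₂, hp, -, -⟩, hpS⟩
      obtain ⟨α, hα, hpα⟩ := hγ.exists_mem hpS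
      refine ⟨α, hα, hpα, cls_eq_of_mem ha hα hpα ?_⟩
      obtain ⟨r, hr⟩ := exists_of_mem_cls hp
      obtain ⟨h1, h2⟩ := (seg_eq_seg_iff _ _ _ _ _ _).1 hr
      rw [seg_bot_eq_iff.2 fun t ht => h2 t (h1 ▸ mem_itv_bot.2 ht), ← hr]
      exact hp
    obtain ⟨α, hα, hpα, h1⟩ := key p hp
    obtain ⟨β, hβ, hqβ, h2⟩ := key q hq
    exact hγ.subset hβ (hγ.glue_mem hβ (h1.trans h2.symm) hpα hqβ hpq)

end IsIdealPartition

end Classes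

/-! ### Arithmetic of the parameter -/

section Parameter

variable {Λ : Type u} [AddCommMonoid Λ] [LinearOrder Λ] [IsParameter Λ]

theorem IsParameter.isOrderedCancelAddMonoid (Λ : Type u) [AddCommMonoid Λ] [LinearOrder Λ]
    [IsParameter Λ] : IsOrderedCancelAddMonoid Λ where
  add_le_add_left a b h c := by
    rcases h.eq_or_lt with rfl | h
    · exact le_rfl
    · exact ((IsParameter.lt_iff_add_lt_add a b c).1 h).le
  le_of_add_le_add_left a b c h := by
    by_contra hlt
    have := (IsParameter.lt_iff_add_lt_add c b a).1 (not_le.1 hlt)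
    rw [add_comm c, add_comm b] at this
    exact this.not_ge h

attribute [local instance] IsParameter.isOrderedCancelAddMonoid

theorem IsParameter.exists_add_of_le {a b : Λ} (h : a ≤ b) : ∃ c, 0 ≤ c ∧ b = a + c := by
  rcases h.eq_or_lt with rfl | h
  · exact ⟨0, le_rfl, (add_zero a).symm⟩
  · obtain ⟨c, rfl⟩ := IsParameter.exists_add_eq_of_lt a b h
    exact ⟨c, (lt_add_iff_pos_right a).1 h |>.le, rfl⟩

/-- The time that has elapsed at `t` since `τ`, if `τ ≤ t`. -/
noncomputable def elapsed (τ t : Λ) : Λ :=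
  open Classical in if h : ∃ c, t = τ + c then h.choose else 0

/-- Cancellation makes the chosen difference unique. The default `0` is never read by `experiment`,
as a difference exists whenever `τ ≤ t`. -/
theorem elapsed_add (τ c : Λ) : elapsed τ (τ + c) = c := by
  have h : ∃ d, τ + c = τ + d := ⟨c, rfl⟩
  rw [elapsed, dif_pos h]
  exact (add_left_cancel h.choose_spec).symm

end Parameter

/-! ### The experiments and their shell -/

section Runs

variable {Λ : Type u} [AddCommMonoid Λ] [LinearOrder Λ] [IsParameter Λ] {P : Type v}
  (γ : Set (Set (Λ → P))) (l : Λ) (p₀ : P)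

attribute [local instance] IsParameter.isOrderedCancelAddMonoid

/-- The state of the closed system at elapsed time `k` of an experiment on a path `s ∈ α` that
starts at `l`: the environment records the elapsed time and the class of `α` at `l + k`. -/
def stateAt (α : Set (Λ → P)) (s : Λ → P) (k : Λ) : P × Option (Λ × Set (Λ →. P)) :=
  (s (l + k), some (k, cls γ α ⊥ (l + k)))

/-- The path of the closed system that is idle before `τ`, when the experiment is started. -/
noncomputable def experiment (τ : Λ) (α : Set (Λ → P)) (s : Λ → P) :
    Λ → P × Option (Λ × Set (Λ →. P)) :=
  fun t => if τ ≤ t then stateAt γ l α s (elapsed τ t) else (p₀, none)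

/-- The paths of the closed system. -/
def experiments : Set (Λ → P × Option (Λ × Set (Λ →. P))) :=
  {p | ∃ τ, ∃ α ∈ γ, ∃ s ∈ α, p = experiment γ l p₀ τ α s}

/-- The states at elapsed time `0`. -/
def initialStates : Set (P × Option (Λ × Set (Λ →. P))) :=
  {x | ∃ α ∈ γ, ∃ s ∈ α, x = stateAt γ l α s 0}

/-- The states at the times at which the cells are decided. -/
def finalStates (m : Set (Λ → P) → Λ) : Set (P × Option (Λ × Set (Λ →. P))) :=
  {x | ∃ α ∈ γ, ∃ s ∈ α, x = stateAt γ l α s (m α)}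

/-- The environmental state that decides for `α`. -/
def verdict (m : Set (Λ → P) → Λ) (α : Set (Λ → P)) : Option (Λ × Set (Λ →. P)) :=
  some (m α, cls γ α ⊥ (l + m α))

/-- The cells of `γ` can be told apart by observing paths from `l` to `l + m α`, where `m α`
depends on the cell `α`. -/
structure IsDecisionTime (m : Set (Λ → P) → Λ) : Prop where
  nonempty : ∀ α ∈ γ, α.Nonempty
  nonneg : ∀ α ∈ γ, 0 ≤ m α
  separates : ∀ α ∈ γ, ∀ β ∈ γ, ∀ k, m α ≤ k → cls γ β ⊥ (l + k) = cls γ α ⊥ (l + k) → β = α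
  glue_mem : ∀ α ∈ γ, ∀ β ∈ γ, ∀ k, cls γ α ⊥ (l + k) = cls γ β ⊥ (l + k) →
    ∀ s ∈ α, ∀ s' ∈ β, s (l + k) = s' (l + k) → glue (l + k) s s' ∈ β
  cls_eq : ∀ α ∈ γ, ∀ β ∈ γ, ∀ s ∈ α, ∀ s' ∈ β, ∀ k, 0 ≤ k →
    (∀ j, 0 ≤ j → j ≤ k → s (l + j) = s' (l + j)) → cls γ α ⊥ (l + k) = cls γ β ⊥ (l + k)

theorem IsIdealPartition.exists_isDecisionTime {S : Set (Λ → P)} {γ : Set (Set (Λ → P))}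
    (hγ : IsIdealPartition S γ) {l : Λ} (hl : ∀ α ∈ γ, StronglyBoundedBelow S α l) :
    ∃ m, IsDecisionTime γ l m := by
  have h : ∀ α : Set (Λ → P), ∃ m : Λ, 0 ≤ m ∧ (α ∈ γ → ∀ β ∈ γ, ∀ k, m ≤ k →
      cls γ β ⊥ (l + k) = cls γ α ⊥ (l + k) → β = α) := by
    intro α
    by_cases hα : α ∈ γ
    · obtain ⟨b, hb⟩ := hγ.above α hα
      -- `m` is `max l b - l`: the maximum makes the difference exist and puts `l + m` beyond the
      -- upper bound `b` of `α`.
      obtain ⟨m, hm, hbm⟩ := IsParameter.exists_add_of_le (le_max_left l b)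
      refine ⟨m, hm, fun _ β hβ k hk h => hγ.eq_of_cls_eq hα hβ hb ?_ h⟩
      calc b ≤ max l b := le_max_right l b
        _ = l + m := hbm
        _ ≤ l + k := by gcongr
    · exact ⟨0, le_rfl, fun h => absurd h hα⟩
  choose m hm hsep using h
  refine ⟨m, fun α hα => hγ.nonempty hα, fun α _ => hm α, hsep, ?_, ?_⟩
  · intro α _ β hβ k h s hs s' hs' hk
    exact hγ.glue_mem hβ h hs hs' hk
  · intro α hα β hβ s hs s' hs' k hk h
    refine hγ.cls_eq_of_agreeOn hl (le_add_of_nonneg_right hk) hα hβ hs hs' fun t ht ht' => ?_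
    obtain ⟨j, hj, rfl⟩ := IsParameter.exists_add_of_le ht
    exact h j hj (le_of_add_le_add_left ht')

variable {γ l p₀} {m : Set (Λ → P) → Λ} {α β : Set (Λ → P)} {s s' : Λ → P} {τ t k : Λ}

theorem experiment_add (hk : 0 ≤ k) : experiment γ l p₀ τ α s (τ + k) = stateAt γ l α s k := by
  simp [experiment, elapsed_add, hk]

theorem experiment_self : experiment γ l p₀ τ α s τ = stateAt γ l α s 0 := by
  simpa using experiment_add (γ := γ) (l := l) (p₀ := p₀) (τ := τ) (α := α) (s := s) le_rfl

theorem experiment_of_lt (h : t < τ) : experiment γ l p₀ τ α s t = (p₀, none) := by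
  simp [experiment, h.not_ge]

theorem lt_or_exists_add (τ t : Λ) : t < τ ∨ ∃ k, 0 ≤ k ∧ t = τ + k :=
  (lt_or_ge t τ).imp id IsParameter.exists_add_of_le

/-- The clock reading fixes the start of the experiment; idle times are excluded because their
record is `none`. -/
theorem eq_add_of_experiment_snd {C : Set (Λ →. P)}
    (h : (experiment γ l p₀ τ α s t).2 = some (k, C)) :
    0 ≤ k ∧ t = τ + k ∧ C = cls γ α ⊥ (l + k) := by
  rcases lt_or_exists_add τ t with ht | ⟨j, hj, rfl⟩
  · simp [experiment_of_lt ht] at h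
  · rw [experiment_add hj] at h
    simp only [stateAt, Option.some.injEq, Prod.mk.injEq] at h
    obtain ⟨rfl, rfl⟩ := h
    exact ⟨hj, rfl, rfl⟩

theorem eq_add_of_experiment_eq (h : experiment γ l p₀ τ α s t = stateAt γ l β s' k) :
    0 ≤ k ∧ t = τ + k ∧ s (l + k) = s' (l + k) ∧ cls γ α ⊥ (l + k) = cls γ β ⊥ (l + k) := by
  obtain ⟨hk, rfl, hC⟩ := eq_add_of_experiment_snd (congrArg Prod.snd h)
  rw [experiment_add hk] at h
  exact ⟨hk, rfl, congrArg Prod.fst h, hC.symm⟩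

theorem experiment_mem_initialStates (hα : α ∈ γ) (hs : s ∈ α) :
    experiment γ l p₀ τ α s t ∈ initialStates γ l ↔ t = τ := by
  constructor
  · rintro ⟨β, -, s', -, h⟩
    simpa using (eq_add_of_experiment_eq h).2.1
  · rintro rfl
    exact ⟨α, hα, s, hs, experiment_self⟩

theorem isHomogeneous_experiments : IsHomogeneous (experiments γ l p₀) := by
  rintro l₁ _ d x ⟨_, ⟨τ₀, α₀, -, s₀, -, rfl⟩, hx⟩ - - rfl p
  have key (τ t : Λ) (α s) : experiment γ l p₀ τ α s t = experiment γ l p₀ (τ + d) α s (t + d) := by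
    rcases lt_or_exists_add τ t with ht | ⟨j, hj, rfl⟩
    · rw [experiment_of_lt ht, experiment_of_lt (by gcongr)]
    · rw [experiment_add hj, add_right_comm, experiment_add hj]
  constructor
  · rintro ⟨⟨τ, α, hα, s, hs, rfl⟩, hp⟩
    exact ⟨_, ⟨τ + d, α, hα, s, hs, rfl⟩, key τ l₁ α s ▸ hp, fun t => key τ t α s⟩
  · rintro ⟨_, ⟨τ', α, hα, s, hs, rfl⟩, hq, hp⟩
    -- The start must be shifted back by `d`, although `Λ` may lack negatives. If `τ'` is later than
    -- `l₁ + d`, the difference exists. Otherwise `x` shows a clock reading `k`, and its occurrence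
    -- at `l₁` in an experiment started at `τ₀` forces `τ' = τ₀ + d`.
    obtain ⟨τ, rfl⟩ : ∃ τ, τ' = τ + d := by
      rcases lt_or_exists_add τ' (l₁ + d) with ht | ⟨k, hk, hlk⟩
      · obtain ⟨c, -, hc⟩ := IsParameter.exists_add_of_le ht.le
        exact ⟨l₁ + c, by rw [hc, add_right_comm]⟩
      · rw [hlk, experiment_add hk, ← hx] at hq
        obtain ⟨-, h, -⟩ := eq_add_of_experiment_eq hq.symm
        refine ⟨τ₀, add_right_cancel (b := k) ?_⟩
        rw [← hlk, h, add_right_comm]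
    have hpe : p = experiment γ l p₀ τ α s := funext fun t => (hp t).trans (key τ t α s).symm
    exact ⟨⟨τ, α, hα, s, hs, hpe⟩, by rw [hp, hq]⟩

/-- An initial state occurs only at the start of an experiment, so it fixes the start as `x` and is
automatically avoided afterwards. -/
theorem seg_mem_afterFromTo {p : Λ → P × Option (Λ × Set (Λ →. P))}
    {A : Set (P × Option (Λ × Set (Λ →. P)))} {x y : Λ} (hxy : x ≤ y) :
    seg p x y ∈ afterFromTo (experiments γ l p₀) (initialStates γ l) (initialStates γ l) A ↔
      ∃ α ∈ γ, ∃ s ∈ α, experiment γ l p₀ x α s y ∈ A ∧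
        ∀ t, x ≤ t → t ≤ y → p t = experiment γ l p₀ x α s t := by
  constructor
  · rintro ⟨_, ⟨τ, α, hα, s, hs, rfl⟩, l₁, l₂, h12, hI, hA, -, hseg⟩
    obtain ⟨rfl, rfl, hp⟩ := (seg_coe_eq_iff hxy h12).1 hseg
    rw [experiment_mem_initialStates hα hs] at hI
    subst hI
    exact ⟨α, hα, s, hs, hA, hp⟩
  · rintro ⟨α, hα, s, hs, hA, hp⟩
    refine ⟨_, ⟨x, α, hα, s, hs, rfl⟩, x, y, hxy, ?_, hA, fun t ht _ h => ?_,
      (seg_coe_eq_iff hxy hxy).2 ⟨rfl, rfl, hp⟩⟩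
    · rw [experiment_mem_initialStates hα hs]
    · rw [experiment_mem_initialStates hα hs] at h
      exact ht.ne' h

namespace IsDecisionTime

theorem cls_eq_of_le (hm : IsDecisionTime γ l m) (hα : α ∈ γ) (hβ : β ∈ γ) {j : Λ} (hjk : j ≤ k)
    (h : cls γ α ⊥ (l + k) = cls γ β ⊥ (l + k)) : cls γ α ⊥ (l + j) = cls γ β ⊥ (l + j) :=
  cls_eq_mono hα hβ (hm.nonempty β hβ) (by gcongr) h

theorem eq_of_verdict (hm : IsDecisionTime γ l m) (hα : α ∈ γ) (hβ : β ∈ γ)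
    (h : (experiment γ l p₀ τ α s t).2 = verdict γ l m β) : α = β ∧ t = τ + m β := by
  obtain ⟨-, ht, hC⟩ := eq_add_of_experiment_snd h
  exact ⟨hm.separates β hβ α hα _ le_rfl hC.symm, ht⟩

theorem experiment_mem_finalStates (hm : IsDecisionTime γ l m) (hα : α ∈ γ) (hs : s ∈ α) :
    experiment γ l p₀ τ α s t ∈ finalStates γ l m ↔ t = τ + m α := by
  constructor
  · rintro ⟨β, hβ, s', -, h⟩
    obtain ⟨rfl, ht⟩ := hm.eq_of_verdict hα hβ (congrArg Prod.snd h)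
    exact ht
  · rintro rfl
    exact ⟨α, hα, s, hs, experiment_add (hm.nonneg α hα)⟩

theorem isDynamicSpace (hm : IsDecisionTime γ l m) (hne : γ.Nonempty) :
    IsDynamicSpace (experiments γ l p₀) := by
  constructor
  · obtain ⟨α, hα⟩ := hne
    obtain ⟨s, hs⟩ := hm.nonempty α hα
    exact ⟨_, 0, α, hα, s, hs, rfl⟩
  rintro _ ⟨τ, α, hα, s, hs, rfl⟩ _ ⟨τ', β, hβ, s', hs', rfl⟩ t h
  rcases lt_or_exists_add τ' t with ht | ⟨k, hk, rfl⟩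
  -- The record `none` at `t` means that both experiments are still idle, so the concatenation is
  -- the second path.
  · rw [experiment_of_lt ht] at h
    have ht' : t < τ := by
      by_contra hlt
      obtain ⟨j, hj, rfl⟩ := IsParameter.exists_add_of_le (not_lt.1 hlt)
      rw [experiment_add hj] at h
      simp [stateAt] at h
    refine ⟨τ', β, hβ, s', hs', funext fun u => ?_⟩
    by_cases hu : u ≤ t
    · simp [glue, hu, experiment_of_lt (hu.trans_lt ht), experiment_of_lt (hu.trans_lt ht')]
    · simp [glue, hu]
  · rw [experiment_add hk] at h
    obtain ⟨-, h1, h2, h3⟩ := eq_add_of_experiment_eq h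
    obtain rfl := add_right_cancel h1
    -- Equal clocks give equal starts, and equal classes keep the glued path in `β`. Up to elapsed
    -- time `k` the records for `α` and `β` coincide, because classes get finer with time.
    refine ⟨τ', β, hβ, _, hm.glue_mem α hα β hβ k h3 s hs s' hs' h2, funext fun u => ?_⟩
    rcases lt_or_exists_add τ' u with hu | ⟨j, hj, rfl⟩
    · simp [glue, experiment_of_lt hu]
    · by_cases hjk : j ≤ k
      · simp [glue, experiment_add hj, stateAt, hjk, hm.cls_eq_of_le hα hβ hjk h3]
      · simp [glue, experiment_add hj, stateAt, hjk]

theorem seg_mem_upToFirst (hm : IsDecisionTime γ l m) {p : Λ → P × Option (Λ × Set (Λ →. P))}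
    {x y : Λ} (hxy : x ≤ y) :
    seg p x y ∈ upToFirst (experiments γ l p₀) (initialStates γ l) (finalStates γ l m) ↔
      ∃ α ∈ γ, ∃ s ∈ α, y = x + m α ∧ ∀ t, x ≤ t → t ≤ y → p t = experiment γ l p₀ x α s t := by
  have hset {τ : Λ} {α s} (hα : α ∈ γ) (hs : s ∈ α) :
      {t | τ ≤ t ∧ experiment γ l p₀ τ α s t ∈ finalStates γ l m} = {τ + m α} := by
    ext t
    simp only [hm.experiment_mem_finalStates hα hs, Set.mem_ofPred_eq, Set.mem_singleton_iff,
      and_iff_right_iff_imp]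
    rintro rfl
    exact le_add_of_nonneg_right (hm.nonneg α hα)
  constructor
  · rintro ⟨_, ⟨τ, α, hα, s, hs, rfl⟩, l₁, l₂, hI, -, hglb, hseg⟩
    rw [experiment_mem_initialStates hα hs] at hI
    subst hI
    rw [hset hα hs] at hglb
    obtain rfl := hglb.unique isGLB_singleton
    obtain ⟨rfl, rfl, hp⟩ := (seg_coe_eq_iff hxy (le_add_of_nonneg_right (hm.nonneg α hα))).1 hseg
    exact ⟨α, hα, s, hs, rfl, hp⟩
  · rintro ⟨α, hα, s, hs, rfl, hp⟩
    refine ⟨_, ⟨x, α, hα, s, hs, rfl⟩, x, x + m α,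
      (experiment_mem_initialStates hα hs).2 rfl, ?_, ?_,
      (seg_coe_eq_iff hxy hxy).2 ⟨rfl, rfl, hp⟩⟩
    · rw [hset hα hs]
      exact Set.singleton_nonempty _
    · rw [hset hα hs]
      exact isGLB_singleton

/-- Each experiment meets the initial states exactly at `τ` and the final states exactly at `τ + m
α`; the last two conditions pair these times. -/
theorem isShell (hm : IsDecisionTime γ l m) (hne : γ.Nonempty) :
    IsShell (experiments γ l p₀) (initialStates γ l) (finalStates γ l m) where
  isDynamicSpace := hm.isDynamicSpace hne
  initial_subset := by
    rintro _ ⟨α, hα, s, hs, rfl⟩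
    exact ⟨_, ⟨0, α, hα, s, hs, rfl⟩, 0, experiment_self⟩
  final_subset := by
    rintro _ ⟨α, hα, s, hs, rfl⟩
    exact ⟨_, ⟨0, α, hα, s, hs, rfl⟩, 0 + m α, experiment_add (hm.nonneg α hα)⟩
  homogeneous := isHomogeneous_experiments
  realized := by
    rintro _ ⟨α, hα, s, hs, rfl⟩ t
    exact ⟨_, ⟨t, α, hα, s, hs, rfl⟩, experiment_self⟩
  from_initial := by
    apply Set.Subset.antisymm
    · rintro _ ⟨_, ⟨τ, α, hα, s, hs, rfl⟩, t, ht, rfl⟩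
      rw [experiment_mem_initialStates hα hs] at ht
      subst ht
      have hle : t ≤ t + m α := le_add_of_nonneg_right (hm.nonneg α hα)
      exact ⟨_, ⟨t, α, hα, s, hs, rfl⟩, t, t + m α, hle, (seg_mem_afterFromTo hle).2
        ⟨α, hα, s, hs, (hm.experiment_mem_finalStates hα hs).2 rfl, fun _ _ _ => rfl⟩, rfl⟩
    · rintro _ ⟨p, hp, x, y, hxy, h, rfl⟩
      obtain ⟨α, hα, s, hs, -, h⟩ := (seg_mem_afterFromTo hxy).1 h
      refine ⟨p, hp, x, ?_, rfl⟩
      rw [h x le_rfl hxy]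
      exact (experiment_mem_initialStates hα hs).2 rfl
  to_final := by
    apply Set.Subset.antisymm
    · rintro _ ⟨_, ⟨τ, α, hα, s, hs, rfl⟩, t, ht, rfl⟩
      rw [hm.experiment_mem_finalStates hα hs] at ht
      subst ht
      have hle : τ ≤ τ + m α := le_add_of_nonneg_right (hm.nonneg α hα)
      exact ⟨_, ⟨τ, α, hα, s, hs, rfl⟩, τ, τ + m α, hle, (seg_mem_afterFromTo hle).2
        ⟨α, hα, s, hs, (hm.experiment_mem_finalStates hα hs).2 rfl, fun _ _ _ => rfl⟩, rfl⟩
    · rintro _ ⟨p, hp, x, y, hxy, h, rfl⟩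
      obtain ⟨α, hα, s, hs, hF, h⟩ := (seg_mem_afterFromTo hxy).1 h
      refine ⟨p, hp, y, ?_, rfl⟩
      rwa [h y hxy le_rfl]

/-- The value `k = m α` is included, since final states are to be avoided only strictly before the
end. -/
theorem mem_shellInt (hm : IsDecisionTime γ l m) {x : P × Option (Λ × Set (Λ →. P))} :
    x ∈ shellInt (experiments γ l p₀) (initialStates γ l) (finalStates γ l m) ↔
      ∃ α ∈ γ, ∃ s ∈ α, ∃ k, 0 ≤ k ∧ k ≤ m α ∧ x = stateAt γ l α s k := by
  constructor
  · rintro ⟨-, _, _, ⟨τ, α, hα, s, hs, rfl⟩, l₁, l₂, h12, hI, rfl, hF, -⟩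
    rw [experiment_mem_initialStates hα hs] at hI
    subst hI
    obtain ⟨k, hk, rfl⟩ := IsParameter.exists_add_of_le h12
    refine ⟨α, hα, s, hs, k, hk, ?_, experiment_add hk⟩
    by_contra hlt
    refine hF (l₁ + m α) (le_add_of_nonneg_right (hm.nonneg α hα)) ?_
      ((hm.experiment_mem_finalStates hα hs).2 rfl)
    have := not_le.1 hlt
    gcongr
  · rintro ⟨α, hα, s, hs, k, hk, hkm, rfl⟩
    refine ⟨⟨_, ⟨0, α, hα, s, hs, rfl⟩, 0 + k, experiment_add hk⟩, _, _,
      ⟨0, α, hα, s, hs, rfl⟩, 0, 0 + k, le_add_of_nonneg_right hk,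
      (experiment_mem_initialStates hα hs).2 rfl, experiment_add hk, ?_, rfl⟩
    intro t _ ht h
    rw [hm.experiment_mem_finalStates hα hs] at h
    subst h
    exact (lt_of_add_lt_add_left ht).not_ge hkm

end IsDecisionTime

end Runs

/-! ### The deciding environmental shell -/

section DecisionShell

variable {Λ : Type u} [AddCommMonoid Λ] [LinearOrder Λ] [IsParameter Λ] {P : Type v}
  {γ : Set (Set (Λ → P))} {l : Λ} {p₀ : P} {m : Set (Λ → P) → Λ} {α β : Set (Λ → P)}
  {s s' : Λ → P} {τ t k : Λ}

attribute [local instance] IsParameter.isOrderedCancelAddMonoid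

theorem experiment_zero (hk : 0 ≤ k) : experiment γ l p₀ 0 α s k = stateAt γ l α s k := by
  simpa using experiment_add (γ := γ) (l := l) (p₀ := p₀) (τ := 0) (α := α) (s := s) hk

theorem experiment_start_fst (ht : l ≤ t) : (experiment γ l p₀ l α s t).1 = s t := by
  obtain ⟨k, hk, rfl⟩ := IsParameter.exists_add_of_le ht
  rw [experiment_add hk, stateAt]

theorem mem_image_snd_finalStates {e : Option (Λ × Set (Λ →. P))} (hm : IsDecisionTime γ l m) :
    e ∈ Prod.snd '' finalStates γ l m ↔ ∃ α ∈ γ, e = verdict γ l m α := by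
  constructor
  · rintro ⟨_, ⟨α, hα, s, hs, rfl⟩, rfl⟩
    exact ⟨α, hα, rfl⟩
  · rintro ⟨α, hα, rfl⟩
    obtain ⟨s, hs⟩ := hm.nonempty α hα
    exact ⟨_, ⟨α, hα, s, hs, rfl⟩, rfl⟩

/-- The environmental shell that decides the partition `γ`. -/
def decisionShell (p₀ : P) (hm : IsDecisionTime γ l m) (hne : γ.Nonempty) :
    EnvShell Λ P (Option (Λ × Set (Λ →. P))) where
  D := experiments γ l p₀
  I := initialStates γ l
  F := finalStates γ l m
  isShell := hm.isShell hne
  sys := Prod.fst '' shellDom (experiments γ l p₀) (initialStates γ l) (finalStates γ l m)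
  envInt := Prod.snd '' shellInt (experiments γ l p₀) (initialStates γ l) (finalStates γ l m)
  envF := Prod.snd '' finalStates γ l m
  int_eq := by
    apply Set.Subset.antisymm
    · rintro _ ⟨⟨-, y, hy, hye⟩, _, ⟨τ, β, hβ, s, hs, rfl⟩, t, rfl⟩
      obtain ⟨α, hα, s', hs', k, hk, hkm, rfl⟩ := hm.mem_shellInt.1 hy
      obtain ⟨-, rfl, hC⟩ := eq_add_of_experiment_snd hye.symm
      refine hm.mem_shellInt.2 ⟨β, hβ, s, hs, k, hk, ?_, experiment_add hk⟩
      -- Past `m β` the class singles out `β`, so `α = β`, and then `k ≤ m α` is violated.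
      by_contra hlt
      have h := hm.separates β hβ α hα k (not_le.1 hlt).le hC
      exact hlt (h ▸ hkm)
    · intro x hx
      exact ⟨⟨⟨x, Or.inr hx, rfl⟩, ⟨x, hx, rfl⟩⟩, hx.1⟩
  final_eq := by
    apply Set.Subset.antisymm
    · rintro _ ⟨⟨-, he⟩, _, ⟨τ, β, hβ, s, hs, rfl⟩, t, rfl⟩
      obtain ⟨α, hα, he⟩ := (mem_image_snd_finalStates hm).1 he
      obtain ⟨rfl, rfl⟩ := hm.eq_of_verdict hβ hα he
      exact (hm.experiment_mem_finalStates hβ hs).2 rfl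
    · intro x hx
      exact ⟨⟨⟨x, Or.inl hx, rfl⟩, ⟨x, hx, rfl⟩⟩, (hm.isShell hne).final_subset hx⟩
  sys_eq := rfl
  envInt_eq := rfl
  envF_eq := rfl

/-! ### Outcomes and the conditions on an ideal e-automaton -/

section

variable {hm : IsDecisionTime γ l m} {hne : γ.Nonempty}

local notation "Zγ" => decisionShell p₀ hm hne

theorem mem_theta {A : Set (P × Option (Λ × Set (Λ →. P)))} {g : Λ →. P × Option (Λ × Set (Λ →. P))}
    (hA : A ∩ states (experiments γ l p₀) ⊆ finalStates γ l m) :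
    g ∈ (Zγ).theta τ A ↔ ∃ α ∈ γ, ∃ s ∈ α, experiment γ l p₀ τ α s (τ + m α) ∈ A ∧
      g = seg (experiment γ l p₀ τ α s) τ (τ + m α : Λ) := by
  constructor
  · rintro ⟨p, l', hl', hp, ⟨p', l'', hl'', hp', hpp'⟩, rfl⟩
    obtain ⟨α, hα, s, hs, rfl, hps⟩ := (hm.seg_mem_upToFirst hl').1 hp
    obtain ⟨β, hβ, s', hs', hpA, hps'⟩ := (seg_mem_afterFromTo (hl'.trans hl'')).1 hp'
    have hpp := ((seg_coe_eq_iff hl' hl').1 hpp').2.2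
    have hF := hA ⟨hpA, _, ⟨τ, β, hβ, s', hs', rfl⟩, l'', rfl⟩
    rw [hm.experiment_mem_finalStates hβ hs'] at hF
    subst hF
    have h1 := hpp _ hl' le_rfl
    rw [hps _ hl' le_rfl, hps' _ hl' hl'', experiment_add (s := s) (hm.nonneg α hα)] at h1
    -- The two experiments agree at `τ + m α`, where the record is the verdict for `α`. The path
    -- `s'` is kept as witness, because its end is known to lie in `A`.
    obtain rfl := (hm.eq_of_verdict hβ hα (congrArg Prod.snd h1)).1
    refine ⟨β, hβ, s', hs', hpA, (seg_coe_eq_iff hl' hl').2 ⟨rfl, rfl, fun t ht ht' => ?_⟩⟩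
    rw [← hps' t ht ht', hpp t ht ht']
  · rintro ⟨α, hα, s, hs, hsA, rfl⟩
    have hle : τ ≤ τ + m α := le_add_of_nonneg_right (hm.nonneg α hα)
    exact ⟨_, _, hle, (hm.seg_mem_upToFirst hle).2 ⟨α, hα, s, hs, rfl, fun _ _ _ => rfl⟩,
      ⟨_, _, le_rfl, (seg_mem_afterFromTo hle).2 ⟨α, hα, s, hs, hsA, fun _ _ _ => rfl⟩, rfl⟩, rfl⟩

theorem mem_theta_final {g : Λ →. P × Option (Λ × Set (Λ →. P))} :
    g ∈ (Zγ).theta τ (Zγ).F ↔ ∃ α ∈ γ, ∃ s ∈ α,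
      g = seg (experiment γ l p₀ τ α s) τ (τ + m α : Λ) := by
  refine (mem_theta Set.inter_subset_left).trans ?_
  refine exists_congr fun α => and_congr_right fun hα => exists_congr fun s =>
    and_congr_right fun hs => and_iff_right ?_
  exact (hm.experiment_mem_finalStates hα hs).2 rfl

theorem mem_outcome {X : Set (Option (Λ × Set (Λ →. P)))} {g : Λ →. P} (hX : X ⊆ (Zγ).envF) :
    g ∈ (Zγ).outcome τ X ↔ ∃ α ∈ γ, verdict γ l m α ∈ X ∧ ∃ s ∈ α,
      g = seg (fun t => (experiment γ l p₀ τ α s t).1) τ (τ + m α : Λ) := by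
  have hA : ((Zγ).sys ×ˢ X) ∩ states (experiments γ l p₀) ⊆ finalStates γ l m := fun x hx =>
    (Zγ).final_eq.subset ⟨⟨hx.1.1, hX hx.1.2⟩, hx.2⟩
  constructor
  · rintro ⟨g, hg, rfl⟩
    obtain ⟨α, hα, s, hs, hsA, rfl⟩ := (mem_theta hA).1 hg
    rw [experiment_add (hm.nonneg α hα)] at hsA
    exact ⟨α, hα, hsA.2, s, hs, map_seg _ _ _ _⟩
  · rintro ⟨α, hα, hαX, s, hs, rfl⟩
    refine ⟨_, (mem_theta hA).2 ⟨α, hα, s, hs, ?_, rfl⟩, map_seg _ _ _ _⟩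
    rw [experiment_add (hm.nonneg α hα)]
    exact ⟨⟨_, Or.inl ⟨α, hα, s, hs, rfl⟩, rfl⟩, hαX⟩

theorem mem_envF {e : Option (Λ × Set (Λ →. P))} :
    e ∈ (Zγ).envF ↔ ∃ α ∈ γ, e = verdict γ l m α :=
  mem_image_snd_finalStates hm

theorem IsDecisionTime.verdict_inj (hm : IsDecisionTime γ l m) (hα : α ∈ γ) (hβ : β ∈ γ)
    (h : verdict γ l m β = verdict γ l m α) : β = α := by
  simp only [verdict, Option.some.injEq, Prod.mk.injEq] at h
  exact hm.separates α hα β hβ (m α) le_rfl (by rw [← h.2, h.1])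

theorem mem_outcome_envF {g : Λ →. P} :
    g ∈ (Zγ).outcome τ (Zγ).envF ↔ ∃ α ∈ γ, ∃ s ∈ α,
      g = seg (fun t => (experiment γ l p₀ τ α s t).1) τ (τ + m α : Λ) := by
  rw [mem_outcome subset_rfl]
  exact exists_congr fun α => and_congr_right fun hα => and_iff_right (mem_envF.2 ⟨α, hα, rfl⟩)

theorem mem_outcome_verdict {g : Λ →. P} (hα : α ∈ γ) :
    g ∈ (Zγ).outcome τ {verdict γ l m α} ↔ ∃ s ∈ α,
      g = seg (fun t => (experiment γ l p₀ τ α s t).1) τ (τ + m α : Λ) := by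
  rw [mem_outcome (Set.singleton_subset_iff.2 (mem_envF.2 ⟨α, hα, rfl⟩))]
  constructor
  · rintro ⟨β, hβ, h, hs⟩
    obtain rfl := hm.verdict_inj hα hβ h
    exact hs
  · exact fun h => ⟨α, hα, rfl, h⟩

theorem IsDecisionTime.cls_eq_of_seg_eq (hm : IsDecisionTime γ l m) (hk : 0 ≤ k) (hα : α ∈ γ)
    (hβ : β ∈ γ) (hs : s ∈ α) (hs' : s' ∈ β)
    (h : seg (fun t => (experiment γ l p₀ 0 α s t).1) (0 : Λ) k =
      seg (fun t => (experiment γ l p₀ 0 β s' t).1) (0 : Λ) k) :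
    cls γ α ⊥ (l + k) = cls γ β ⊥ (l + k) := by
  refine hm.cls_eq α hα β hβ s hs s' hs' k hk fun j hj hjk => ?_
  have := ((seg_coe_eq_iff hk hk).1 h).2.2 j hj hjk
  simpa only [experiment_zero hj, stateAt] using this

theorem exists_of_mem_outcomeUpTo {g : Λ →. P} (hα : α ∈ γ)
    (hg : g ∈ (Zγ).outcomeUpTo (verdict γ l m α) k) :
    0 ≤ k ∧ ∃ s ∈ α, g = seg (fun t => (experiment γ l p₀ 0 α s t).1) (0 : Λ) k := by
  obtain ⟨q, l', hk, hkl, hq, rfl⟩ := hg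
  obtain ⟨s, hs, hqs⟩ := (mem_outcome_verdict hα).1 hq
  obtain ⟨-, -, h⟩ := (seg_coe_eq_iff (hk.trans hkl)
    (le_add_of_nonneg_right (hm.nonneg α hα))).1 hqs
  exact ⟨hk, s, hs, (seg_coe_eq_iff hk hk).2 ⟨rfl, rfl, fun t ht htk => h t ht (htk.trans hkl)⟩⟩

/-- Outcomes that share a system segment on `[0, t]` come from cells of the same class at `l + t`,
so a chain of outcomes stays within one class of `γ`. -/
theorem cls_eq_of_mem_outcomeCls (hα : α ∈ γ) (hβ : β ∈ γ) (hs : s ∈ β) (hk : 0 ≤ k)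
    (h : seg (fun t => (experiment γ l p₀ 0 β s t).1) (0 : Λ) k ∈
      (Zγ).outcomeCls (verdict γ l m α) t) :
    k = t ∧ cls γ β ⊥ (l + t) = cls γ α ⊥ (l + t) := by
  have hsub : (Zγ).outcomeCls (verdict γ l m α) t ⊆ {g | ∀ (k : Λ) β s, 0 ≤ k → β ∈ γ → s ∈ β →
      g = seg (fun t => (experiment γ l p₀ 0 β s t).1) (0 : Λ) k →
      k = t ∧ cls γ β ⊥ (l + t) = cls γ α ⊥ (l + t)} := by
    refine chain_subset ?_ ?_
    · rintro g hg k β s hk hβ hs h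
      obtain ⟨ht, q, hq, rfl⟩ := exists_of_mem_outcomeUpTo hα hg
      obtain ⟨-, rfl, -⟩ := (seg_coe_eq_iff ht hk).1 h
      exact ⟨rfl, (hm.cls_eq_of_seg_eq hk hα hβ hq hs h).symm⟩
    · rintro B ⟨e, he, rfl⟩ ⟨g₀, hg₀, hT⟩ g hg k β s hk hβ hs h
      obtain ⟨δ, hδ, rfl⟩ := mem_envF.1 he
      obtain ⟨ht, q₀, hq₀, h₀⟩ := exists_of_mem_outcomeUpTo hδ hg₀
      obtain ⟨-, q, hq, rfl⟩ := exists_of_mem_outcomeUpTo hδ hg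
      obtain ⟨-, rfl, -⟩ := (seg_coe_eq_iff ht hk).1 h
      exact ⟨rfl, (hm.cls_eq_of_seg_eq hk hδ hβ hq hs h).symm.trans
        (hT t δ q₀ hk hδ hq₀ h₀).2⟩
  exact hsub h k β s hk hβ hs rfl

/-- Undifferentiated states carry the same time and the same class. With equal system components
they are therefore the same state, and the condition is trivial. -/
theorem weaklyUnbiased_decisionShell : (Zγ).WeaklyUnbiased := by
  intro t x e₁ e₂ h₁ h₂ hU
  have key : ∀ e, (x, e) ∈ (Zγ).thetaStatesAt t → ∀ α ∈ γ, ∀ k,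
      ((Zγ).sigmaTo {(x, e)} ∩ (Zγ).outcomeCls (verdict γ l m α) k).Nonempty →
      e = some (k, cls γ α ⊥ (l + k)) := by
    rintro e ⟨p, l₂, ht, htl, hp, hpt⟩ α hα k ⟨_, ⟨q, l₃, l₄, h3, h34, hq, hqe, rfl⟩, hcls⟩
    obtain ⟨β, hβ, s, hs, hps⟩ := mem_theta_final.1 hp
    obtain ⟨δ, hδ, r, hr, hqr⟩ := mem_theta_final.1 hq
    obtain ⟨-, -, hps⟩ := (seg_coe_eq_iff (ht.trans htl)
      (le_add_of_nonneg_right (hm.nonneg β hβ))).1 hps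
    obtain ⟨-, -, hqr⟩ := (seg_coe_eq_iff (h3.trans h34)
      (le_add_of_nonneg_right (hm.nonneg δ hδ))).1 hqr
    rw [hps t ht htl, experiment_zero ht] at hpt
    rw [Set.mem_singleton_iff, hqr l₃ h3 h34, experiment_zero h3] at hqe
    have hfst : seg (fun t => (q t).1) (0 : Λ) l₃ =
        seg (fun t => (experiment γ l p₀ 0 δ r t).1) (0 : Λ) l₃ :=
      (seg_coe_eq_iff h3 h3).2 ⟨rfl, rfl, fun t ht ht' => by rw [hqr t ht (ht'.trans h34)]⟩
    rw [hfst] at hcls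
    obtain ⟨rfl, hc⟩ := cls_eq_of_mem_outcomeCls hα hδ hr h3 hcls
    rw [← hc]
    exact (congrArg Prod.snd hqe).symm
  obtain ⟨-, -, e, he, k, -, hk₁, hk₂⟩ := hU
  obtain ⟨α, hα, rfl⟩ := mem_envF.1 he
  obtain rfl : e₁ = e₂ := (key e₁ h₁ α hα k hk₁).trans (key e₂ h₂ α hα k hk₂).symm
  have hrefl : EnvShell.Follows t ((Zγ).sigmaFrom {(x, e₁)}) ((Zγ).sigmaFrom {(x, e₁)}) :=
    fun s₁ l₁ hl₁ h => ⟨s₁, l₁, hl₁, h, rfl⟩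
  exact ⟨hrefl, hrefl⟩

theorem automataCondition_decisionShell : (Zγ).AutomataCondition := by
  intro s₁ s₂ l₁ l₂ h₁ h₂ hlt heq
  obtain ⟨α, hα, s, hs, h₁⟩ := mem_outcome_envF.1 h₁
  obtain ⟨β, hβ, s', hs', h₂⟩ := mem_outcome_envF.1 h₂
  have key : ∀ {q : Λ → P} {k : Λ} {α s}, α ∈ γ →
      seg q (0 : Λ) k = seg (fun t => (experiment γ l p₀ 0 α s t).1) (0 : Λ) (0 + m α : Λ) →
      k = m α ∧ ∀ t, 0 ≤ t → t ≤ k → q t = (experiment γ l p₀ 0 α s t).1 := by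
    intro q k α s hα h
    obtain ⟨h1, h2⟩ := (seg_eq_seg_iff _ _ _ _ _ _).1 h
    have h0 := hm.nonneg α hα
    -- The sign of `k` is not given, but `[0, k]` equals `[0, m α]`, which contains `0`.
    have hk : 0 ≤ k := (mem_itv_coe.1 (h1.symm ▸ mem_itv_coe.2 ⟨le_rfl, by simpa using h0⟩ :
      (0 : Λ) ∈ itv ((0 : Λ) : WithBot Λ) (k : WithTop Λ))).2
    obtain ⟨-, h3, h4⟩ := (seg_coe_eq_iff hk (by simpa using h0)).1 h
    exact ⟨by simpa using h3, h4⟩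
  obtain ⟨rfl, h₁⟩ := key hα h₁
  obtain ⟨rfl, h₂⟩ := key hβ h₂
  have h0 := hm.nonneg α hα
  have hagree := ((seg_coe_eq_iff h0 h0).1 heq).2.2
  have hc := hm.cls_eq_of_seg_eq h0 hα hβ hs hs' ((seg_coe_eq_iff (p := fun t =>
    (experiment γ l p₀ 0 α s t).1) h0 h0).2 ⟨rfl, rfl, fun t ht ht' => by
      rw [← h₁ t ht ht', hagree t ht ht', h₂ t ht (ht'.trans hlt.le)]⟩)
  exact hlt.ne (congrArg m (hm.separates α hα β hβ _ le_rfl hc.symm)).symm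

/-- A common segment has length `m α = m β`, and observation for that long identifies the cell. -/
theorem isBoolean_decisionShell : (Zγ).IsBoolean := by
  intro e he e' he'
  obtain ⟨α, hα, rfl⟩ := mem_envF.1 he
  obtain ⟨β, hβ, rfl⟩ := mem_envF.1 he'
  refine or_iff_not_imp_right.2 fun h => ?_
  obtain ⟨g, hg, hg'⟩ := Set.nonempty_iff_ne_empty.2 h
  obtain ⟨s, hs, rfl⟩ := (mem_outcome_verdict hα).1 hg
  obtain ⟨s', hs', hss⟩ := (mem_outcome_verdict hβ).1 hg'
  have h0 := le_add_of_nonneg_right (a := (0 : Λ)) (hm.nonneg α hα)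
  obtain ⟨-, h1, -⟩ := (seg_coe_eq_iff h0 (le_add_of_nonneg_right (hm.nonneg β hβ))).1 hss
  rw [← h1, zero_add] at hss
  rw [hm.separates α hα β hβ _ le_rfl
    (hm.cls_eq_of_seg_eq (hm.nonneg α hα) hα hβ hs hs' hss).symm]

theorem isAllReet_decisionShell : (Zγ).IsAllReet := by
  intro e he ē L hē
  obtain ⟨α, hα, rfl⟩ := mem_envF.1 he
  obtain ⟨_, ⟨p, L', hL', hp, rfl⟩, hpē⟩ := hē
  replace hpē : PFun.map Prod.snd (seg p (0 : Λ) L') = seg ē (0 : Λ) L := hpē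
  obtain ⟨β, hβ, s, hs, ⟨-, hβα⟩, hps⟩ := (seg_mem_afterFromTo hL').1 hp
  obtain ⟨rfl, rfl⟩ := hm.eq_of_verdict hβ hα hβα
  rw [map_seg] at hpē
  rw [zero_add] at hL' hpē hps
  have hL : 0 ≤ L := by
    have := ((seg_eq_seg_iff _ _ _ _ _ _).1 hpē).1
    exact (mem_itv_coe.1 (this ▸ mem_itv_coe.2 ⟨le_rfl, hL'⟩ :
      (0 : Λ) ∈ itv ((0 : Λ) : WithBot Λ) (L : WithTop Λ))).2
  obtain ⟨-, rfl, hē⟩ := (seg_coe_eq_iff hL' hL).1 hpē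
  replace hē : ∀ t, 0 ≤ t → t ≤ m β → ē t = some (t, cls γ β ⊥ (l + t)) := by
    intro t ht ht'
    rw [← hē t ht ht', hps t ht ht', experiment_zero ht, stateAt]
  apply Set.Subset.antisymm
  · rintro _ ⟨_, ⟨q, l', hl', hq, ⟨q', ⟨-, hq'ē⟩, hqq'⟩, rfl⟩, rfl⟩
    obtain ⟨δ, hδ, r, hr, hqr⟩ := mem_theta_final.1 hq
    rw [map_seg] at hq'ē
    have h0 := hm.nonneg δ hδ
    have hl'0 : 0 ≤ l' := by
      have := ((seg_eq_seg_iff _ _ _ _ _ _).1 hqr).1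
      exact (mem_itv_coe.1 (this.symm ▸ mem_itv_coe.2 ⟨le_rfl, by simpa using h0⟩ :
        (0 : Λ) ∈ itv ((0 : Λ) : WithBot Λ) (l' : WithTop Λ))).2
    obtain ⟨-, h1, h2⟩ := (seg_coe_eq_iff hl'0 (le_add_of_nonneg_right h0)).1 hqr
    rw [zero_add] at h1
    subst h1
    -- At time `m δ` the environmental path shows the class of `β`, while the run shows that of `δ`;
    -- there the class of `δ` contains no other cell.
    have h3 := ((seg_coe_eq_iff hL hL).1 hq'ē).2.2 _ h0 hl'
    rw [((seg_coe_eq_iff h0 h0).1 hqq').2.2 _ h0 le_rfl, h2 _ h0 le_rfl, experiment_zero h0,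
      hē _ h0 hl'] at h3
    simp only [stateAt, Option.some.injEq, Prod.mk.injEq, true_and] at h3
    obtain rfl := hm.separates δ hδ β hβ _ le_rfl h3.symm
    refine (mem_outcome_verdict hα).2 ⟨r, hr, ?_⟩
    rw [hqr]
    exact map_seg _ _ _ _
  · intro g hg
    obtain ⟨r, hr, rfl⟩ := (mem_outcome_verdict hα).1 hg
    -- The record depends on the cell and not on the path in it, so every `r ∈ β` runs along `ē`.
    refine ⟨seg (experiment γ l p₀ 0 β r) (0 : Λ) (m β : Λ), ⟨_, _, le_rfl,
      mem_theta_final.2 ⟨β, hβ, r, hr, by rw [zero_add]⟩, ⟨_, ⟨⟨_, _, hL,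
        (seg_mem_afterFromTo hL).2 ⟨β, hβ, r, hr, Or.inl
          ((hm.experiment_mem_finalStates hβ hr).2 (zero_add _).symm), fun _ _ _ => rfl⟩, rfl⟩,
        ?_⟩, rfl⟩, rfl⟩, ?_⟩
    · rw [map_seg, seg_coe_eq_iff hL hL]
      refine ⟨rfl, rfl, fun t ht ht' => ?_⟩
      rw [hē t ht ht', experiment_zero ht, stateAt]
    · rw [zero_add]
      exact map_seg _ _ _ _

theorem isIdeal_decisionShell : (Zγ).IsIdeal :=
  ⟨⟨weaklyUnbiased_decisionShell, automataCondition_decisionShell⟩, isBoolean_decisionShell,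
    isAllReet_decisionShell⟩

/-! ### Recovering the partition from the outcomes -/

theorem IsIdealPartition.plus_outcome_verdict {S : Set (Λ → P)} (hγ : IsIdealPartition S γ)
    (hα : α ∈ γ) : plus S ((Zγ).outcome l {verdict γ l m α}) = α := by
  have hseg (s : Λ → P) : seg (fun t => (experiment γ l p₀ l α s t).1) l (l + m α : Λ) =
      seg s l (l + m α : Λ) := by
    have hle : l ≤ l + m α := le_add_of_nonneg_right (hm.nonneg α hα)
    exact (seg_coe_eq_iff hle hle).2 ⟨rfl, rfl, fun t ht _ => experiment_start_fst ht⟩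
  apply Set.Subset.antisymm
  · rintro q ⟨⟨x₁, x₂, hq, -, -⟩, hqS⟩
    obtain ⟨s, hs, hqs⟩ := (mem_outcome_verdict hα).1 hq
    rw [hseg] at hqs
    obtain ⟨h1, h2⟩ := (seg_eq_seg_iff _ _ _ _ _ _).1 hqs
    obtain ⟨β, hβ, hqβ⟩ := hγ.exists_mem hqS
    -- Agreement with a path of `α` on `[l, l + m α]` alone already fixes the class there, hence the
    -- cell.
    have hc := hm.cls_eq β hβ α hα q hqβ s hs (m α) (hm.nonneg α hα) fun j hj hjm =>
      h2 _ (h1 ▸ mem_itv_coe.2 ⟨le_add_of_nonneg_right hj, by gcongr⟩)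
    exact hm.separates α hα β hβ _ le_rfl hc ▸ hqβ
  · intro s hs
    have hsS := hγ.subset hα hs
    exact ⟨⟨l, (l + m α : Λ), (mem_outcome_verdict hα).2 ⟨s, hs, (hseg s).symm⟩,
      ⟨s, hsS, fun _ _ => rfl⟩, ⟨s, hsS, fun _ _ => rfl⟩⟩, hsS⟩

theorem IsIdealPartition.decides_decisionShell {S : Set (Λ → P)} (hγ : IsIdealPartition S γ)
    (hl : ∀ α ∈ γ, StronglyBoundedBelow S α l) : (Zγ).Decides S γ := by
  refine ⟨hγ.partition.1, l, ?_, hγ.isUnbiasedFor hl, ?_⟩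
  · intro s l' hl' h
    obtain ⟨α, hα, q, hq, h⟩ := mem_outcome_envF.1 h
    obtain ⟨-, -, h⟩ := (seg_coe_eq_iff hl' (le_add_of_nonneg_right (hm.nonneg α hα))).1 h
    refine ⟨q, hγ.subset hα hq, (seg_coe_eq_iff hl' hl').2 ⟨rfl, rfl, fun t ht ht' => ?_⟩⟩
    rw [h t ht ht', experiment_start_fst ht]
  · ext α
    constructor
    · intro hα
      exact ⟨_, mem_envF.2 ⟨α, hα, rfl⟩, (hγ.plus_outcome_verdict hα).symm⟩
    · rintro ⟨e, he, rfl⟩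
      obtain ⟨β, hβ, rfl⟩ := mem_envF.1 he
      rwa [hγ.plus_outcome_verdict hβ]

end

end DecisionShell

end Dyn

theorem mainTheorem2 {Λ : Type u} [AddCommMonoid Λ] [LinearOrder Λ] [Dyn.IsParameter Λ]
    {P : Type v} (S : Set (Λ → P)) (hS : Dyn.IsDynamicSet S)
    (γ : Set (Set (Λ → P))) (hγ : Dyn.IsIdealPartition S γ) :
    ∃ (ε : Type (max u v)) (Z : Dyn.EnvShell Λ P ε), Z.IsIdeal ∧ Z.Decides S γ := by
  obtain ⟨s, hs⟩ := hS
  obtain ⟨α, hα, -⟩ := hγ.exists_mem hs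
  obtain ⟨l, hl⟩ := hγ.below
  obtain ⟨m, hm⟩ := hγ.exists_isDecisionTime hl
  -- The idle system state is arbitrary, since the record `none` already marks idleness; `s 0`
  -- merely shows that some state exists.
  exact ⟨_, Dyn.decisionShell (s 0) hm ⟨α, hα⟩, Dyn.isIdeal_decisionShell,
    hγ.decides_decisionShell hl⟩
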